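/- **Setting.** Let $n\ge 1$, let $1<\mathfrak p^-\le \mathfrak p^+<\infty$ with $\mathfrak p^->\frac{2n}{n+2}$, and let $L,m_\varepsilon>0$. Fix $q>1$ and $\beta_0$ with $0<\beta_0<1-\frac1q$, $\beta_0\le\frac12$, $\mathfrak p^--\beta_0>\frac{2n}{n+2}$. Points of $\mathbb R^{n+1}$ are written $z=(x,t)$ with $x\in\mathbb R^n$, $t\in\mathbb R$; put $d_p(z_1,z_2)=\max\{|x_1-x_2|,\sqrt{|t_1-t_2|}\}$. For an exponent $p:\mathbb R^{n+1}\to\mathbb R$ and $d\in(0,1)$, $\mu\ge 1$, $r>0$ let $$B_r^\mu(z)=B_{\mu^{-\frac1{p(z)}+\frac d2}r}(x),\quad I_r^\mu(z)=(t-\mu^{-1+d}r^2,\,t+\mu^{-1+d}r^2),\quad Q_r^\mu(z)=B_r^\mu(z)\times I_r^\mu(z),$$ $$d_z^\mu(z_1,z_2)=\max\Big\{\mu^{\frac1{p(z)}-\frac d2}|x_1-x_2|,\ \sqrt{\mu^{1-d}|t_1-t_2|}\Big\},$$ and for $c>0$ let $cQ_r^\mu(z)=Q_{cr}^\mu(z)$.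 The letter $d$ without arguments always denotes the exponent chosen below. Assume the following. * $\Omega\subset\mathbb R^n$ is a bounded domain with $|\Omega^c\cap B_r(y)|\ge m_\varepsilon|B_r(y)|$ for all $y\in\partial\Omega$, $r>0$; $T>0$, $\Omega_T=\Omega\times(-T,T)$, and $z_0=(x_0,t_0)\in\partial\Omega\times(-T,T)$. * $\mathfrak p^-\le p(\cdot)\le\mathfrak p^+$, and $|p(z_1)-p(z_2)|\le\omega(d_p(z_1,z_2))$ for all $z_1,z_2$, where $\omega:[0,\infty)\to[0,\infty)$ is continuous and non-decreasing, $\omega(r)\to0$ as $r\to0$, and $\omega(r)\log\frac1r\le L$ for $0<r\le\frac12$. * $0<\beta<\beta_0$, $p(\cdot)(1-\beta)>1$, and $u\in L^{p(\cdot)(1-\beta)}(-T,T;W_0^{1,p(\cdot)(1-\beta)}(\Omega))$ with weak spatial gradient $\nabla u$ (for instance a very weak solution of $u_t-\operatorname{div}\mathcal A(x,t,\nabla u)=0$ with zero lateral boundary values). Both $u$ and $\nabla u$ are extended by $0$ outside $\Omega_T$. Put ${\bf M}_0=\iint_{\Omega_T}(|u|+|\nabla u|+1)^{p(z)(1-\beta)}\,dz$.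 * $0<\rho_0<1$, $\rho_0\le\frac1{1024{\bf M}_0}$, $\omega(512\rho_0)\le\frac12\min\{\frac1{n+2},\frac14\}$ and $\frac{L}{\log(1/\rho_0)}\le\frac1n$. Let $p^-$ and $p^+$ be the infimum and the supremum of $p$ over $B_{128\rho_0}(x_0)\times(t_0-(128\rho_0)^2,t_0+(128\rho_0)^2)$. * $\frac{2n}{(n+2)p^-}<d<\min\{\frac2{p^+},1\}$, $q<\frac{p^-}{p^+-1}$ and $2\beta_0\le\frac{d(n+2)}2-\frac n{p^-}$. * $0<\rho\le\frac{\rho_0}{128}$, $\alpha_0\ge1$, and, with $\langle f\rangle_S=\frac1{|S|}\iint_S f\,dz$ denoting the mean value, $$\alpha_0^{1-\beta}\le \big\langle(|\nabla u|+1)^{p(\cdot)(1-\beta)}\big\rangle_{Q_\rho^{\alpha_0}(z_0)},\qquad \big\langle(|\nabla u|+1)^{p(\cdot)(1-\beta)}\big\rangle_{Q_{16\rho}^{\alpha_0}(z_0)}\le\alpha_0^{1-\beta}.$$ * $\rho\le\rho_a<\rho_b\le16\rho$ and $\lambda\ge\alpha_0$. Let $\mathcal M f(z)$ be the supremum of the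 mean values of $|f|$ over all cylinders $B_a(y)\times(s-b^2,s+b^2)$, $a,b>0$, that contain $z$, and put $$g=\mathcal M\Big(\Big[|\nabla u|+1+\frac{|u|}{\alpha_0^{-\frac1{p(z_0)}+\frac d2}\rho}\Big]^{\frac{p(\cdot)}q}\chi_{Q_{\rho_b}^{\alpha_0}(z_0)}\Big)^{q(1-\beta)},\qquad E_\lambda=\{z\in\mathbb R^{n+1}:g(z)\le\lambda^{1-\beta}\},$$ and $\rho_z=\inf_{w\in E_\lambda}d_z^\lambda(z,w)$. **Lemma (Whitney covering).** There are constants $\mathfrak X\ge9$, $\hat c\ge9$, $C>0$ and $N\in\mathbb N$, depending only on $n,\mathfrak p^\pm,L,m_\varepsilon$ and on the fixed numbers $q,\beta_0$, such that in every situation as above the following holds with $\delta=\frac1{4\hat c}$. There is a countable set of points $z_i\in Q_{\rho_b}^{\alpha_0}(z_0)\setminus E_\lambda$ such that the cylinders $\mathfrak X^{-1}Q_i=Q^\lambda_{\frac\delta{\mathfrak X}\rho_{z_i}}(z_i)$ are pairwise disjoint and the cylinders $Q_i=Q_{\delta\rho_{z_i}}^\lambda(z_i)=B_i\times I_i$ satisfy: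 * (W1) $Q_{\rho_b}^{\alpha_0}(z_0)\setminus E_\lambda\subset\bigcup_iQ_i$. * (W2) Each point of $Q_{\rho_b}^{\alpha_0}(z_0)\setminus E_\lambda$ belongs to at most $N$ of the cylinders $2Q_i$. * (W3) If $2Q_i\cap2Q_j\ne\emptyset$, then $|B_i|\le C|B_j|$, $|I_i|\le C|I_j|$, $|Q_i|\le C|Q_j|$, and the same with $i$ and $j$ exchanged. * (W4) For all $i$: $\hat cQ_i\subset\mathbb R^{n+1}\setminus E_\lambda$ and $8\hat cQ_i\cap E_\lambda\ne\emptyset$. * (W5) If $2Q_i\cap2Q_j\ne\emptyset$, then $2Q_i\subset\hat cQ_j$. -/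

import Mathlib

open Set Filter Topology MeasureTheory
open scoped ENNReal

noncomputable section

namespace Whitney

/-- Space-time `ℝⁿ × ℝ`; a point is `z = (x, t)`. The first factor carries the Euclidean norm. -/
abbrev SpaceTime (n : ℕ) : Type := EuclideanSpace ℝ (Fin n) × ℝ

variable {n : ℕ}

/-! ### Parabolic cylinders and metrics -/

/-- The parabolic metric `d_p(z₁, z₂) = max {|x₁ - x₂|, √|t₁ - t₂|}`. -/
def parDist (z₁ z₂ : SpaceTime n) : ℝ :=
  max (dist z₁.1 z₂.1) (Real.sqrt |z₁.2 - z₂.2|)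

/-- The cylinder `Q_{a,b}(z) = B_a(x) × (t - b², t + b²)`. -/
def cylinder (z : SpaceTime n) (a b : ℝ) : Set (SpaceTime n) :=
  Metric.ball z.1 a ×ˢ Ioo (z.2 - b ^ 2) (z.2 + b ^ 2)

/-- The intrinsic spatial scaling factor `μ^{-1/p(z) + d/2}`. -/
def scaleX (p : SpaceTime n → ℝ) (d μ : ℝ) (z : SpaceTime n) : ℝ :=
  μ ^ (-(1 / p z) + d / 2)

/-- The intrinsic time scaling factor `μ^{-1 + d}`. -/
def scaleT (d μ : ℝ) : ℝ := μ ^ (-1 + d)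

/-- The ball `B_{μ^{-1/p(z) + d/2} r}(x)`, where `z = (x, t)`. -/
def intrinsicBall (p : SpaceTime n → ℝ) (d μ : ℝ) (z : SpaceTime n) (r : ℝ) :
    Set (EuclideanSpace ℝ (Fin n)) :=
  Metric.ball z.1 (scaleX p d μ z * r)

/-- The interval `(t - μ^{-1+d} r², t + μ^{-1+d} r²)`, where `z = (x, t)`. -/
def intrinsicInterval (d μ : ℝ) (z : SpaceTime n) (r : ℝ) : Set ℝ :=
  Ioo (z.2 - scaleT d μ * r ^ 2) (z.2 + scaleT d μ * r ^ 2)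

/-- The intrinsic cylinder `Q_r^μ(z)`. For `c > 0`, its multiple `c Q_r^μ(z)` is `Q_{cr}^μ(z)`. -/
def intrinsicCylinder (p : SpaceTime n → ℝ) (d μ : ℝ) (z : SpaceTime n) (r : ℝ) :
    Set (SpaceTime n) :=
  intrinsicBall p d μ z r ×ˢ intrinsicInterval d μ z r

/-- The localized parabolic metric
`d_z^μ(z₁, z₂) = max {μ^{1/p(z) - d/2} |x₁ - x₂|, √(μ^{1-d} |t₁ - t₂|)}`. -/
def locDist (p : SpaceTime n → ℝ) (d μ : ℝ) (z z₁ z₂ : SpaceTime n) : ℝ :=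
  max (μ ^ (1 / p z - d / 2) * dist z₁.1 z₂.1) (Real.sqrt (μ ^ (1 - d) * |z₁.2 - z₂.2|))

/-- `ρ_z = d_z^μ(z, E) = inf_{w ∈ E} d_z^μ(z, w)`. -/
def distToSet (p : SpaceTime n → ℝ) (d μ : ℝ) (E : Set (SpaceTime n)) (z : SpaceTime n) : ℝ :=
  sInf (locDist p d μ z z '' E)

/-! ### The variable exponent -/

/-- `p` takes values in `[pm, pp]` and is log-Hölder continuous with constant `L` and modulus of
continuity `om` with respect to the parabolic metric. -/
structure IsLogHolder (pm pp L : ℝ) (p : SpaceTime n → ℝ) (om : ℝ → ℝ) : Prop where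
  bounds : ∀ z, pm ≤ p z ∧ p z ≤ pp
  nonneg : ∀ r, 0 ≤ r → 0 ≤ om r
  mono : MonotoneOn om (Ici 0)
  cont : ContinuousOn om (Ici 0)
  tendsto_zero : Tendsto om (𝓝[>] 0) (𝓝 0)
  modulus : ∀ z₁ z₂, |p z₁ - p z₂| ≤ om (parDist z₁ z₂)
  log_bound : ∀ r, 0 < r → r ≤ 1 / 2 → om r * Real.log (1 / r) ≤ L

/-- `p⁻_S`, the infimum of `p` over `S`. -/
def expInf (p : SpaceTime n → ℝ) (S : Set (SpaceTime n)) : ℝ := sInf (p '' S)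

/-- `p⁺_S`, the supremum of `p` over `S`. -/
def expSup (p : SpaceTime n → ℝ) (S : Set (SpaceTime n)) : ℝ := sSup (p '' S)

/-! ### The domain and the function space -/

/-- `Ω` is a bounded domain (nonempty, open, connected) whose complement satisfies the uniform
measure density condition with constant `m`. -/
structure IsMeasureDensityDomain (m : ℝ) (Ω : Set (EuclideanSpace ℝ (Fin n))) : Prop where
  isOpen : IsOpen Ω
  isConnected : IsConnected Ω
  bounded : Bornology.IsBounded Ω
  density : ∀ y ∈ frontier Ω, ∀ r : ℝ, 0 < r →
    ENNReal.ofReal m * volume (Metric.ball y r) ≤ volume (Ωᶜ ∩ Metric.ball y r)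

/-- The space-time domain `Ω_T = Ω × (-T, T)`. -/
def spaceTimeDomain (Ω : Set (EuclideanSpace ℝ (Fin n))) (T : ℝ) : Set (SpaceTime n) :=
  Ω ×ˢ Ioo (-T) T

/-- `v ∈ W₀^{1,s(·)}(Ω)` with weak gradient `Dv`: the pair `(v, Dv)` is the limit of
`(φ_k, ∇φ_k)` with `φ_k ∈ C_c^∞(Ω)`, in the modular of `L^{s(·)}(Ω)` (for a bounded exponent
this is the same as convergence in the Luxemburg norm). -/
def MemW01 (s : EuclideanSpace ℝ (Fin n) → ℝ) (Ω : Set (EuclideanSpace ℝ (Fin n)))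
    (v : EuclideanSpace ℝ (Fin n) → ℝ)
    (Dv : EuclideanSpace ℝ (Fin n) → EuclideanSpace ℝ (Fin n)) : Prop :=
  ∃ φ : ℕ → EuclideanSpace ℝ (Fin n) → ℝ,
    (∀ k, ContDiff ℝ (⊤ : ℕ∞) (φ k) ∧ HasCompactSupport (φ k) ∧ tsupport (φ k) ⊆ Ω) ∧
    Tendsto (fun k => ∫⁻ x in Ω,
        (ENNReal.ofReal (|φ k x - v x| ^ s x) +
          ENNReal.ofReal (‖gradient (φ k) x - Dv x‖ ^ s x)))
      atTop (𝓝 0)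

/-- `u ∈ L^{s(·)}(-T, T; W₀^{1,s(·)}(Ω))` with weak spatial gradient `Du`. -/
structure MemLpW01 (s : SpaceTime n → ℝ) (Ω : Set (EuclideanSpace ℝ (Fin n))) (T : ℝ)
    (u : SpaceTime n → ℝ) (Du : SpaceTime n → EuclideanSpace ℝ (Fin n)) : Prop where
  meas : AEStronglyMeasurable u (volume.restrict (spaceTimeDomain Ω T))
  meas_grad : AEStronglyMeasurable Du (volume.restrict (spaceTimeDomain Ω T))
  modular : ∫⁻ z in spaceTimeDomain Ω T,
    (ENNReal.ofReal (|u z| ^ s z) + ENNReal.ofReal (‖Du z‖ ^ s z)) < ∞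
  slice : ∀ᵐ t ∂(volume.restrict (Ioo (-T) T)),
    MemW01 (fun x => s (x, t)) Ω (fun x => u (x, t)) (fun x => Du (x, t))

/-- The extension of a function on `Ω_T` by zero. -/
def zeroExt {F : Type*} [Zero F] (Ω : Set (EuclideanSpace ℝ (Fin n))) (T : ℝ)
    (f : SpaceTime n → F) : SpaceTime n → F :=
  (spaceTimeDomain Ω T).indicator f

/-- `M₀ = ∬_{Ω_T} (|u| + |∇u| + 1)^{p(z)(1-β)} dz`. -/
def totalEnergy (p : SpaceTime n → ℝ) (β : ℝ) (Ω : Set (EuclideanSpace ℝ (Fin n))) (T : ℝ)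
    (u : SpaceTime n → ℝ) (Du : SpaceTime n → EuclideanSpace ℝ (Fin n)) : ℝ≥0∞ :=
  ∫⁻ z in spaceTimeDomain Ω T, ENNReal.ofReal ((|u z| + ‖Du z‖ + 1) ^ (p z * (1 - β)))

/-- The mean value of `(|∇u| + 1)^{p(z)(1-β)}` over `S`, with `∇u` extended by zero. -/
def meanEnergy (p : SpaceTime n → ℝ) (β : ℝ) (Ω : Set (EuclideanSpace ℝ (Fin n))) (T : ℝ)
    (Du : SpaceTime n → EuclideanSpace ℝ (Fin n)) (S : Set (SpaceTime n)) : ℝ≥0∞ :=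
  ⨍⁻ z in S, ENNReal.ofReal ((‖zeroExt Ω T Du z‖ + 1) ^ (p z * (1 - β))) ∂volume

/-! ### The maximal function and the good set -/

/-- The strong (uncentred) parabolic maximal function: the supremum of the mean values over all
cylinders `Q_{a,b}` containing the point. -/
def strongMaximal (f : SpaceTime n → ℝ≥0∞) (z : SpaceTime n) : ℝ≥0∞ :=
  ⨆ (c : SpaceTime n) (a : ℝ) (b : ℝ) (_ : 0 < a) (_ : 0 < b) (_ : z ∈ cylinder c a b),
    ⨍⁻ w in cylinder c a b, f w ∂volume

/-- The function
`g = M([|∇u| + 1 + |u| / (α₀^{-1/p(z₀)+d/2} ρ)]^{p(·)/q} χ_{Q_{ρ_b}^{α₀}(z₀)})^{q(1-β)}`. -/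
def gFun (p : SpaceTime n → ℝ) (d q β : ℝ) (Ω : Set (EuclideanSpace ℝ (Fin n))) (T : ℝ)
    (u : SpaceTime n → ℝ) (Du : SpaceTime n → EuclideanSpace ℝ (Fin n))
    (α₀ : ℝ) (z₀ : SpaceTime n) (ρ ρb : ℝ) (z : SpaceTime n) : ℝ≥0∞ :=
  strongMaximal
    ((intrinsicCylinder p d α₀ z₀ ρb).indicator fun w =>
      ENNReal.ofReal
        ((‖zeroExt Ω T Du w‖ + 1 + |zeroExt Ω T u w| / (scaleX p d α₀ z₀ * ρ)) ^ (p w / q))) z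
    ^ (q * (1 - β))

/-- The good set `E_λ = {z : g(z) ≤ λ^{1-β}}`. -/
def goodSet (p : SpaceTime n → ℝ) (d q β : ℝ) (Ω : Set (EuclideanSpace ℝ (Fin n))) (T : ℝ)
    (u : SpaceTime n → ℝ) (Du : SpaceTime n → EuclideanSpace ℝ (Fin n))
    (α₀ : ℝ) (z₀ : SpaceTime n) (ρ ρb lam : ℝ) : Set (SpaceTime n) :=
  {z | gFun p d q β Ω T u Du α₀ z₀ ρ ρb z ≤ ENNReal.ofReal (lam ^ (1 - β))}

/-! ### Whitney coverings -/

/-- The countable set `Z` of centres gives a Whitney covering of `Q \ E` by the intrinsic cylinders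
`Q_i = Q_{δ ρ_{z_i}}^λ(z_i)`, `z_i ∈ Z`, where `δ = 1 / (4 ĉ)` and `ρ_z = d_z^λ(z, E)`. -/
structure IsWhitneyCovering (p : SpaceTime n → ℝ) (d lam : ℝ) (Q E : Set (SpaceTime n))
    (X chat C : ℝ) (N : ℕ) (Z : Set (SpaceTime n)) : Prop where
  countable : Z.Countable
  centres : Z ⊆ Q \ E
  /-- The cylinders `X⁻¹ Q_i` of the family `{Q_{(δ/X) ρ_z}^λ(z)}` are pairwise disjoint. -/
  disjoint : Z.PairwiseDisjoint fun z =>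
    intrinsicCylinder p d lam z (1 / (4 * chat) / X * distToSet p d lam E z)
  /-- The cylinders `Q_i` cover. -/
  cover : Q \ E ⊆ ⋃ z ∈ Z, intrinsicCylinder p d lam z (1 / (4 * chat) * distToSet p d lam E z)
  /-- The doubled cylinders have bounded overlap. -/
  overlap : ∀ w ∈ Q \ E,
    {z ∈ Z | w ∈ intrinsicCylinder p d lam z
      (2 * (1 / (4 * chat) * distToSet p d lam E z))}.encard ≤ N
  /-- Neighbouring cylinders have comparable sizes; the condition is symmetric in the two
  cylinders, so each estimate also holds in the other direction. -/
  comparable : ∀ z ∈ Z, ∀ w ∈ Z,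
    (intrinsicCylinder p d lam z (2 * (1 / (4 * chat) * distToSet p d lam E z)) ∩
      intrinsicCylinder p d lam w (2 * (1 / (4 * chat) * distToSet p d lam E w))).Nonempty →
    volume (intrinsicBall p d lam z (1 / (4 * chat) * distToSet p d lam E z)) ≤
      ENNReal.ofReal C *
        volume (intrinsicBall p d lam w (1 / (4 * chat) * distToSet p d lam E w)) ∧
    volume (intrinsicInterval d lam z (1 / (4 * chat) * distToSet p d lam E z)) ≤
      ENNReal.ofReal C *
        volume (intrinsicInterval d lam w (1 / (4 * chat) * distToSet p d lam E w)) ∧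
    volume (intrinsicCylinder p d lam z (1 / (4 * chat) * distToSet p d lam E z)) ≤
      ENNReal.ofReal C *
        volume (intrinsicCylinder p d lam w (1 / (4 * chat) * distToSet p d lam E w))
  /-- `ĉ Q_i` lies in the complement of `E`. -/
  subset_compl : ∀ z ∈ Z,
    intrinsicCylinder p d lam z (chat * (1 / (4 * chat) * distToSet p d lam E z)) ⊆ Eᶜ
  /-- `8 ĉ Q_i` meets `E`. -/
  meets : ∀ z ∈ Z,
    (intrinsicCylinder p d lam z (8 * chat * (1 / (4 * chat) * distToSet p d lam E z)) ∩
      E).Nonempty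
  /-- If `2 Q_i` and `2 Q_j` meet, then `2 Q_i ⊆ ĉ Q_j`. -/
  neighbour : ∀ z ∈ Z, ∀ w ∈ Z,
    (intrinsicCylinder p d lam z (2 * (1 / (4 * chat) * distToSet p d lam E z)) ∩
      intrinsicCylinder p d lam w (2 * (1 / (4 * chat) * distToSet p d lam E w))).Nonempty →
    intrinsicCylinder p d lam z (2 * (1 / (4 * chat) * distToSet p d lam E z)) ⊆
      intrinsicCylinder p d lam w (chat * (1 / (4 * chat) * distToSet p d lam E w))

end Whitney

end

/-! Only one estimate is not soft: if z, w lie in the base cylinder off E and `parDist z w` is at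
most max(ρ_z, ρ_w), then λ^{|1/p(z)-1/p(w)|} ≤ Θ, with Θ depending only on the data
(`IsSetting.rpow_abs_le`). It makes the metrics `locDist` centred at neighbouring points equivalent
up to Θ, and the covering then follows from Vitali's lemma as in the classical Whitney argument
(`IsComparable.exists_isWhitneyCovering`).

With σ = `parDist z w`, the exponents differ by at most ω(σ), and ω(σ) log(1/σ) ≤ L; so it suffices
that λ is at most a power of 1/σ. A cylinder of intrinsic radius r ≤ ρ_v about v misses E, hence the
strong maximal function exceeds λ^{1/q} on all of it. A weak type (s,s) estimate with s = q(1-β₀) >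
1 bounds λ^{1-β₀}|Q_r^λ(v)| by the energy, while the condition on d gives |Q_r^λ(v)| ≥ c λ^{2β₀-1}
r^{n+2}. Thus λ^{β₀} r^{n+2} is controlled by powers of α₀ and 1/ρ (`upperLevel_le`), and the lower
bound on the mean energy controls α₀ by a power of 1/ρ (`level_le`). Taking r = σ ≤ 32ρ leaves a
power of 1/σ. Taking r large instead shows that E is nonempty.

The weak type estimate is needed only on products B × I (`rpow_mul_volume_le_of_lt_strongMaximal`).
The strong maximal function is dominated by a maximal function in time followed by one in space: the
weak (1,1) bound in space is applied on each time slice to the part of the time maximal function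
above a level l, and the integral of that part is bounded by l^{1-s} ∫ f^s. -/

namespace Whitney

/-! ### Weak type estimates over balls -/

/-- Weak type `(1,1)` estimate for the uncentred maximal operator over balls. -/
theorem mul_measure_le_of_forall_exists_ball {E : Type*} [NormedAddCommGroup E] [NormedSpace ℝ E]
    [FiniteDimensional ℝ E] [Nontrivial E] [MeasurableSpace E] [BorelSpace E] (μ : Measure E)
    [μ.IsAddHaarMeasure] (h : E → ℝ≥0∞) (τ : ℝ≥0∞) (A : Set E)
    (hA : ∀ a ∈ A, ∃ (c : E) (r : ℝ), 0 < r ∧ a ∈ Metric.ball c r ∧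
      τ * μ (Metric.ball c r) ≤ ∫⁻ x in Metric.ball c r, h x ∂μ) :
    τ * μ A ≤ ENNReal.ofReal (5 ^ Module.finrank ℝ E) * ∫⁻ x, h x ∂μ := by
  set D := Module.finrank ℝ E with hD
  have hDpos : 0 < D := Module.finrank_pos
  rcases eq_or_ne (∫⁻ x, h x ∂μ) ∞ with hI | hI
  · rw [hI, ENNReal.mul_top (by positivity)]; exact le_top
  rcases eq_or_ne τ 0 with rfl | hτ
  · simp
  choose! cen rad hrad hmem hle using hA
  have hball1 : μ (Metric.ball (0 : E) 1) ≠ 0 := (Metric.measure_ball_pos μ _ one_pos).ne'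
  have hball1' : μ (Metric.ball (0 : E) 1) ≠ ∞ := measure_ball_lt_top.ne
  -- Vitali's lemma needs bounded radii; τ μ(ball) ≤ ∫ h < ∞ bounds the D-th power of the radius,
  -- and r ≤ max(1, r^D).
  have hbdd : ∀ a ∈ A,
      rad a ≤ 1 + ((∫⁻ x, h x ∂μ) / (τ * μ (Metric.ball (0 : E) 1))).toReal := by
    intro a ha
    have h1 := (hle a ha).trans (setLIntegral_le_lintegral _ _)
    rw [Measure.addHaar_ball_of_pos μ _ (hrad a ha), ← hD] at h1
    have h2 : ENNReal.ofReal (rad a ^ D) ≤ (∫⁻ x, h x ∂μ) / (τ * μ (Metric.ball (0 : E) 1)) := by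
      rw [ENNReal.le_div_iff_mul_le (Or.inl (mul_ne_zero hτ hball1)) (Or.inr hI)]
      calc _ = _ := by ring
        _ ≤ _ := h1
    have hfin : (∫⁻ x, h x ∂μ) / (τ * μ (Metric.ball (0 : E) 1)) ≠ ∞ :=
      ENNReal.div_ne_top hI (mul_ne_zero hτ hball1)
    have h3 := (ENNReal.ofReal_le_iff_le_toReal hfin).1 h2
    rcases le_total (rad a) 1 with h4 | h4
    · exact h4.trans (le_add_of_nonneg_right ENNReal.toReal_nonneg)
    · have := le_self_pow₀ h4 hDpos.ne'
      linarith
  obtain ⟨u, huA, hdisj, hcov⟩ := Vitali.exists_disjoint_subfamily_covering_enlargement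
    (fun a => Metric.ball (cen a) (rad a)) A rad 2 one_lt_two (fun a ha => (hrad a ha).le) _ hbdd
    (fun a ha => ⟨a, hmem a ha⟩)
  have hcount : u.Countable := hdisj.countable_of_isOpen (fun _ _ => Metric.isOpen_ball)
    (fun a ha => ⟨a, hmem a (huA ha)⟩)
  -- Only the point a has to be covered: it lies within 2 `rad a` + `rad b` ≤ 5 `rad b` of the
  -- centre of a selected ball.
  have hsub : A ⊆ ⋃ b ∈ u, Metric.ball (cen b) (5 * rad b) := by
    intro a ha
    obtain ⟨b, hb, ⟨y, hya, hyb⟩, hab⟩ := hcov a ha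
    refine mem_iUnion₂.2 ⟨b, hb, ?_⟩
    have h1 := hmem a ha
    rw [Metric.mem_ball] at *
    have h2 := dist_triangle4_left a (cen b) (cen a) y
    have h3 := dist_triangle a (cen a) y
    have h4 := dist_triangle a y (cen b)
    rw [dist_comm] at hya
    linarith
  calc τ * μ A ≤ τ * ∑' b : u, μ (Metric.ball (cen b) (5 * rad b)) := by
        gcongr
        exact (measure_mono hsub).trans (measure_biUnion_le _ hcount _)
    _ = ENNReal.ofReal (5 ^ D) * ∑' b : u, τ * μ (Metric.ball (cen b) (rad b)) := by
        have h5 : ∀ b : u, μ (Metric.ball (cen b) (5 * rad b)) =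
            ENNReal.ofReal (5 ^ D) * μ (Metric.ball (cen b) (rad b)) := by
          intro b
          rw [Measure.addHaar_ball_of_pos μ _ (hrad b (huA b.2)),
            Measure.addHaar_ball_of_pos μ _ (mul_pos (by norm_num) (hrad b (huA b.2))), ← hD,
            mul_pow, ENNReal.ofReal_mul (by positivity), mul_assoc]
        simp only [h5, ENNReal.tsum_mul_left]
        ring
    _ ≤ ENNReal.ofReal (5 ^ D) * ∑' b : u, ∫⁻ x in Metric.ball (cen b) (rad b), h x ∂μ := by
        gcongr with b
        exact hle b (huA b.2)
    _ = ENNReal.ofReal (5 ^ D) * ∫⁻ x in ⋃ b ∈ u, Metric.ball (cen b) (rad b), h x ∂μ := by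
        rw [lintegral_biUnion hcount (fun b _ => Metric.isOpen_ball.measurableSet) hdisj]
    _ ≤ _ := mul_le_mul' le_rfl (setLIntegral_le_lintegral _ _)

/-- Hölder's inequality for the mean value over a set, in the form of a lower bound. -/
theorem rpow_mul_measure_le_of_mul_measure_le {α : Type*} [MeasurableSpace α] {μ : Measure α}
    {f : α → ℝ≥0∞} (S : Set α) (hf : AEMeasurable f (μ.restrict S)) {τ : ℝ≥0∞} {s : ℝ} (hs : 1 < s)
    (hS : μ S ≠ 0) (hS' : μ S ≠ ∞) (h : τ * μ S ≤ ∫⁻ x in S, f x ∂μ) :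
    τ ^ s * μ S ≤ ∫⁻ x in S, f x ^ s ∂μ := by
  have hs0 : 0 < s := by linarith
  have hconj := Real.HolderConjugate.conjExponent hs
  have h1 := ENNReal.lintegral_mul_le_Lp_mul_Lq (μ.restrict S) hconj hf
    (aemeasurable_const (b := (1 : ℝ≥0∞)))
  simp only [Pi.mul_apply, mul_one, ENNReal.one_rpow, lintegral_const, one_mul,
    Measure.restrict_apply_univ] at h1
  have h2 := ENNReal.rpow_le_rpow (h.trans h1) hs0.le
  rw [ENNReal.mul_rpow_of_nonneg _ _ hs0.le, ENNReal.mul_rpow_of_nonneg _ _ hs0.le,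
    ← ENNReal.rpow_mul, ← ENNReal.rpow_mul, one_div, inv_mul_cancel₀ hs0.ne', ENNReal.rpow_one]
    at h2
  have he : 1 / s.conjExponent * s = s - 1 := by
    rw [Real.conjExponent]; field_simp
  rw [he] at h2
  have h3 : μ S ^ s = μ S * μ S ^ (s - 1) := by
    nth_rewrite 2 [← ENNReal.rpow_one (μ S)]
    rw [← ENNReal.rpow_add _ _ hS hS']; ring_nf
  rw [h3, ← mul_assoc] at h2
  have h4 : μ S ^ (s - 1) ≠ 0 := by simp [hS, hS']
  have h5 : μ S ^ (s - 1) ≠ ∞ := by simp [hS, hS']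
  exact (ENNReal.mul_le_mul_iff_left h4 h5).1 h2

/-- Weak type `(s,s)` estimate for the uncentred maximal operator over balls. -/
theorem rpow_mul_measure_le_of_forall_exists_ball {E : Type*} [NormedAddCommGroup E]
    [NormedSpace ℝ E] [FiniteDimensional ℝ E] [Nontrivial E] [MeasurableSpace E] [BorelSpace E]
    (μ : Measure E) [μ.IsAddHaarMeasure] {h : E → ℝ≥0∞} (hh : AEMeasurable h μ) (τ : ℝ≥0∞)
    {s : ℝ} (hs : 1 < s) (A : Set E)
    (hA : ∀ a ∈ A, ∃ (c : E) (r : ℝ), 0 < r ∧ a ∈ Metric.ball c r ∧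
      τ * μ (Metric.ball c r) ≤ ∫⁻ x in Metric.ball c r, h x ∂μ) :
    τ ^ s * μ A ≤ ENNReal.ofReal (5 ^ Module.finrank ℝ E) * ∫⁻ x, h x ^ s ∂μ := by
  refine mul_measure_le_of_forall_exists_ball μ (fun x => h x ^ s) (τ ^ s) A fun a ha => ?_
  obtain ⟨c, r, hr, hac, hle⟩ := hA a ha
  exact ⟨c, r, hr, hac, rpow_mul_measure_le_of_mul_measure_le _ hh.restrict hs
    (Metric.measure_ball_pos μ _ hr).ne' measure_ball_lt_top.ne hle⟩

end Whitney

/-! ### The maximal function in time -/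

namespace Whitney

variable {n : ℕ}

/-- The uncentred maximal function in the time variable, over intervals with rational endpoints. -/
noncomputable def timeMaximal (f : SpaceTime n → ℝ≥0∞) (z : SpaceTime n) : ℝ≥0∞ :=
  ⨆ (a : ℚ) (b : ℚ), (Prod.snd ⁻¹' Ioo (a : ℝ) b).indicator
    (fun z : SpaceTime n => (∫⁻ τ in Ioo (a : ℝ) b, f (z.1, τ)) / volume (Ioo (a : ℝ) b)) z

theorem measurable_timeMaximal {f : SpaceTime n → ℝ≥0∞} (hf : Measurable f) :
    Measurable (timeMaximal f) := by
  refine Measurable.iSup fun a => Measurable.iSup fun b =>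
    Measurable.indicator ?_ (measurable_snd measurableSet_Ioo)
  have h : Measurable fun x => ∫⁻ τ in Ioo (a : ℝ) b, f (x, τ) := hf.lintegral_prod_right'
  exact (h.comp measurable_fst).div_const _

/-- Rational endpoints make the supremum countable, hence measurable. An arbitrary interval sits in
a rational one of at most twice its length, which costs the factor 2. -/
theorem setLIntegral_Ioo_le_timeMaximal (f : SpaceTime n → ℝ≥0∞) (x : EuclideanSpace ℝ (Fin n))
    {α γ t : ℝ} (ht : t ∈ Ioo α γ) :
    ∫⁻ τ in Ioo α γ, f (x, τ) ≤ volume (Ioo α γ) * (2 * timeMaximal f (x, t)) := by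
  have hlt : α < γ := ht.1.trans ht.2
  obtain ⟨a, ha1, ha2⟩ := exists_rat_btwn (show α - (γ - α) / 2 < α by linarith)
  obtain ⟨b, hb1, hb2⟩ := exists_rat_btwn (show γ < γ + (γ - α) / 2 by linarith)
  have hmem : t ∈ Ioo (a : ℝ) b := ⟨ha2.trans ht.1, ht.2.trans hb1⟩
  have hle : (∫⁻ τ in Ioo (a : ℝ) b, f (x, τ)) / volume (Ioo (a : ℝ) b) ≤
      timeMaximal f (x, t) := by
    refine le_trans (le_of_eq ?_) (le_iSup₂ a b)
    rw [indicator_of_mem (show ((x, t) : SpaceTime n) ∈ Prod.snd ⁻¹' Ioo (a : ℝ) b from hmem)]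
  have hvol : volume (Ioo (a : ℝ) b) ≠ 0 := by
    rw [Real.volume_Ioo, Ne, ENNReal.ofReal_eq_zero, not_le]; linarith
  rw [ENNReal.div_le_iff hvol (by simp)] at hle
  calc ∫⁻ τ in Ioo α γ, f (x, τ) ≤ ∫⁻ τ in Ioo (a : ℝ) b, f (x, τ) :=
        lintegral_mono_set (Ioo_subset_Ioo ha2.le hb1.le)
    _ ≤ timeMaximal f (x, t) * volume (Ioo (a : ℝ) b) := hle
    _ ≤ timeMaximal f (x, t) * (2 * volume (Ioo α γ)) := by
        gcongr
        rw [Real.volume_Ioo, Real.volume_Ioo, ← ENNReal.ofReal_ofNat 2,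
          ← ENNReal.ofReal_mul (by norm_num)]
        exact ENNReal.ofReal_le_ofReal (by linarith)
    _ = _ := by ring

theorem rpow_mul_volume_lt_timeMaximal_le {f : SpaceTime n → ℝ≥0∞} (hf : Measurable f)
    (x : EuclideanSpace ℝ (Fin n)) {s : ℝ} (hs : 1 < s) (τ : ℝ≥0∞) :
    τ ^ s * volume {t | τ < timeMaximal f (x, t)} ≤ 5 * ∫⁻ t, f (x, t) ^ s := by
  have h := rpow_mul_measure_le_of_forall_exists_ball volume
    (h := fun t => f (x, t)) (by fun_prop) τ hs {t | τ < timeMaximal f (x, t)} ?_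
  · simpa using h
  intro t ht
  obtain ⟨a, b, hab⟩ : ∃ a b : ℚ, τ < (Prod.snd ⁻¹' Ioo (a : ℝ) b).indicator
      (fun z : SpaceTime n => (∫⁻ τ in Ioo (a : ℝ) b, f (z.1, τ)) / volume (Ioo (a : ℝ) b))
        (x, t) := by
    simpa only [mem_ofPred_eq, timeMaximal, lt_iSup_iff] using ht
  have hmem : t ∈ Ioo (a : ℝ) b := by
    by_contra hmem
    rw [indicator_of_notMem (show ((x, t) : SpaceTime n) ∉ Prod.snd ⁻¹' Ioo (a : ℝ) b from hmem)]
      at hab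
    exact not_lt_bot hab
  rw [indicator_of_mem (show ((x, t) : SpaceTime n) ∈ Prod.snd ⁻¹' Ioo (a : ℝ) b from hmem)] at hab
  refine ⟨((a : ℝ) + b) / 2, ((b : ℝ) - a) / 2, by linarith [hmem.1, hmem.2], ?_, ?_⟩
  · rwa [← Real.Ioo_eq_ball]
  · rw [← Real.Ioo_eq_ball]
    refine ENNReal.mul_le_of_le_div hab.le

/-- The part of the maximal function in time above the level `l`. -/
noncomputable def timeMaximalAbove (f : SpaceTime n → ℝ≥0∞) (l : ℝ≥0∞) : SpaceTime n → ℝ≥0∞ :=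
  {z | l < timeMaximal f z}.indicator (timeMaximal f)

theorem measurable_timeMaximalAbove {f : SpaceTime n → ℝ≥0∞} (hf : Measurable f) (l : ℝ≥0∞) :
    Measurable (timeMaximalAbove f l) :=
  (measurable_timeMaximal hf).indicator
    (measurableSet_lt measurable_const (measurable_timeMaximal hf))

theorem timeMaximal_le_add (f : SpaceTime n → ℝ≥0∞) (l : ℝ≥0∞) (z : SpaceTime n) :
    timeMaximal f z ≤ l + timeMaximalAbove f l z := by
  by_cases h : l < timeMaximal f z
  · rw [timeMaximalAbove, indicator_of_mem (by exact h)]; exact le_add_self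
  · exact (not_lt.1 h).trans le_self_add

/-- Dyadic decomposition of the values above a level. -/
theorem le_tsum_dyadic {l y : ℝ≥0∞} (hl : l ≠ 0) (hl' : l ≠ ∞) (hy : l < y) :
    y ≤ ∑' k : ℕ, if 2 ^ k * l < y then 2 ^ (k + 1) * l else 0 := by
  rcases eq_or_ne y ∞ with rfl | hy'
  · have h : ∀ k : ℕ, l ≤ if (2 : ℝ≥0∞) ^ k * l < ∞ then 2 ^ (k + 1) * l else 0 := by
      intro k
      rw [if_pos (ENNReal.mul_lt_top (by finiteness) hl'.lt_top)]
      exact le_mul_of_one_le_left' (one_le_pow₀ one_le_two)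
    refine le_trans (le_of_eq ?_) (ENNReal.tsum_le_tsum h)
    rw [ENNReal.tsum_const_eq_top_of_ne_zero hl]
  have hex : ∃ k : ℕ, y ≤ 2 ^ k * l := by
    have h1 : y / l < ∞ := ENNReal.div_lt_top hy' hl
    obtain ⟨k, hk⟩ := ENNReal.exists_nat_gt h1.ne
    refine ⟨k, ?_⟩
    rw [← ENNReal.div_le_iff hl hl']
    refine hk.le.trans ?_
    exact_mod_cast (Nat.lt_two_pow_self (n := k)).le
  classical
  have hmin := Nat.find_spec hex
  have hpos : Nat.find hex ≠ 0 := by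
    intro h0
    rw [h0, pow_zero, one_mul] at hmin
    exact absurd hy (not_lt.2 hmin)
  obtain ⟨k, hk⟩ := Nat.exists_eq_succ_of_ne_zero hpos
  have hlt : 2 ^ k * l < y := not_le.1 (Nat.find_min hex (by omega))
  refine le_trans ?_ (ENNReal.le_tsum k)
  rw [if_pos hlt]
  rwa [hk] at hmin

/-- The constant of the maximal estimates in the time variable. -/
noncomputable def timeConst (s : ℝ) : ℝ≥0∞ := 10 * (1 - 2 ^ (1 - s))⁻¹

theorem timeConst_ne_top {s : ℝ} (hs : 1 < s) : timeConst s ≠ ∞ := by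
  refine ENNReal.mul_ne_top (by norm_num) (ENNReal.inv_ne_top.2 ?_)
  rw [Ne, tsub_eq_zero_iff_le, not_le]
  exact ENNReal.rpow_lt_one_of_one_lt_of_neg (by norm_num) (by linarith)

/-- The weak (s,s) bound is summed over the dyadic levels 2^k l. Since s > 1 the terms decay like
2^{k(1-s)}, and the geometric series produces `timeConst`. -/
theorem lintegral_timeMaximalAbove_le {f : SpaceTime n → ℝ≥0∞} (hf : Measurable f)
    (x : EuclideanSpace ℝ (Fin n)) {s : ℝ} (hs : 1 < s) {l : ℝ≥0∞} (hl : l ≠ 0) (hl' : l ≠ ∞) :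
    l ^ (s - 1) * ∫⁻ t, timeMaximalAbove f l (x, t) ≤ timeConst s * ∫⁻ t, f (x, t) ^ s := by
  have hM : Measurable fun t => timeMaximal f (x, t) :=
    (measurable_timeMaximal hf).comp measurable_prodMk_left
  have hset : ∀ k : ℕ, MeasurableSet {t | 2 ^ k * l < timeMaximal f (x, t)} :=
    fun k => measurableSet_lt measurable_const hM
  have h1 : ∀ t, timeMaximalAbove f l (x, t) ≤
      ∑' k : ℕ, {t | 2 ^ k * l < timeMaximal f (x, t)}.indicator
        (fun _ => (2 : ℝ≥0∞) ^ (k + 1) * l) t := by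
    intro t
    by_cases h : l < timeMaximal f (x, t)
    · rw [timeMaximalAbove, indicator_of_mem (by exact h)]
      refine (le_tsum_dyadic hl hl' h).trans (le_of_eq (tsum_congr fun k => ?_))
      simp [indicator_apply]
    · rw [timeMaximalAbove, indicator_of_notMem (by exact h)]; exact zero_le
  -- The factor l^{s-1} 2^{k+1} l is rewritten as 2 (2^{1-s})^k (2^k l)^s, so that the weak type
  -- bound at level 2^k l applies.
  have hterm : ∀ k : ℕ, l ^ (s - 1) *
      (2 ^ (k + 1) * l * volume {t | 2 ^ k * l < timeMaximal f (x, t)}) ≤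
      (10 * ∫⁻ t, f (x, t) ^ s) * ((2 : ℝ≥0∞) ^ (1 - s)) ^ k := by
    intro k
    have h2 := rpow_mul_volume_lt_timeMaximal_le hf x hs (2 ^ k * l)
    have h3 : l ^ (s - 1) * (2 ^ (k + 1) * l) =
        2 * ((2 : ℝ≥0∞) ^ (1 - s)) ^ k * (2 ^ k * l) ^ s := by
      have e1 : l ^ (s - 1) * l = l ^ s := by
        nth_rewrite 2 [← ENNReal.rpow_one l]
        rw [← ENNReal.rpow_add _ _ hl hl']; ring_nf
      have e2 : ((2 : ℝ≥0∞) ^ (1 - s)) ^ k * ((2 : ℝ≥0∞) ^ k) ^ s = 2 ^ k := by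
        rw [← ENNReal.rpow_natCast, ← ENNReal.rpow_natCast, ← ENNReal.rpow_mul,
          ← ENNReal.rpow_mul, ← ENNReal.rpow_add _ _ (by norm_num) (by norm_num)]
        ring_nf
      rw [ENNReal.mul_rpow_of_nonneg _ _ (by linarith), ← e1]
      calc _ = 2 * 2 ^ k * (l ^ (s - 1) * l) := by ring
        _ = 2 * (((2 : ℝ≥0∞) ^ (1 - s)) ^ k * ((2 : ℝ≥0∞) ^ k) ^ s) * (l ^ (s - 1) * l) := by
          rw [e2]
        _ = _ := by ring
    rw [← mul_assoc, h3, mul_assoc]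
    calc _ ≤ 2 * ((2 : ℝ≥0∞) ^ (1 - s)) ^ k * (5 * ∫⁻ t, f (x, t) ^ s) := by gcongr
      _ = _ := by ring
  calc l ^ (s - 1) * ∫⁻ t, timeMaximalAbove f l (x, t)
      ≤ l ^ (s - 1) * ∫⁻ t, ∑' k : ℕ, {t | 2 ^ k * l < timeMaximal f (x, t)}.indicator
        (fun _ => (2 : ℝ≥0∞) ^ (k + 1) * l) t := by
        gcongr with t; exact h1 t
    _ = ∑' k : ℕ, l ^ (s - 1) *
          (2 ^ (k + 1) * l * volume {t | 2 ^ k * l < timeMaximal f (x, t)}) := by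
        rw [lintegral_tsum (fun k => (measurable_const.indicator (hset k)).aemeasurable),
          ← ENNReal.tsum_mul_left]
        refine tsum_congr fun k => ?_
        rw [lintegral_indicator_const (hset k)]
    _ ≤ ∑' k : ℕ, (10 * ∫⁻ t, f (x, t) ^ s) * ((2 : ℝ≥0∞) ^ (1 - s)) ^ k :=
        ENNReal.tsum_le_tsum hterm
    _ = _ := by
        rw [ENNReal.tsum_mul_left, ENNReal.tsum_geometric, timeConst]; ring

/-! ### The strong maximal function on products -/

/-- The constant of the maximal estimate for the strong maximal function. -/
noncomputable def strongConst (n : ℕ) (s : ℝ) : ℝ≥0∞ := ENNReal.ofReal (5 ^ n) * timeConst s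

theorem strongConst_ne_top (n : ℕ) {s : ℝ} (hs : 1 < s) : strongConst n s ≠ ∞ :=
  ENNReal.mul_ne_top ENNReal.ofReal_ne_top (timeConst_ne_top hs)

theorem volume_cylinder_eq (z : SpaceTime n) (a b : ℝ) :
    volume (cylinder z a b) =
      volume (Metric.ball z.1 a) * volume (Ioo (z.2 - b ^ 2) (z.2 + b ^ 2)) := by
  rw [cylinder, Measure.volume_eq_prod, Measure.prod_prod]

/-- On a cylinder with mean above 4l, the inner time integral is at most 2|J| (l + G), where G is
the time maximal function above l. Hence 2(l + mean of G) ≥ 4l, and G has mean at least l on the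
spatial ball. -/
theorem exists_ball_of_lt_strongMaximal {f : SpaceTime n → ℝ≥0∞} (hf : Measurable f)
    {l : ℝ≥0∞} (hl' : l ≠ ∞) {x : EuclideanSpace ℝ (Fin n)} {t : ℝ}
    (h : 4 * l < strongMaximal f (x, t)) :
    ∃ (c : EuclideanSpace ℝ (Fin n)) (r : ℝ), 0 < r ∧ x ∈ Metric.ball c r ∧
      l * volume (Metric.ball c r) ≤ ∫⁻ y in Metric.ball c r, timeMaximalAbove f l (y, t) := by
  simp only [strongMaximal, lt_iSup_iff] at h
  obtain ⟨c, a, b, ha, hb, hmem, hlt⟩ := h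
  refine ⟨c.1, a, ha, hmem.1, ?_⟩
  set J := Ioo (c.2 - b ^ 2) (c.2 + b ^ 2) with hJ
  have hJt : t ∈ J := hmem.2
  have hJ0 : volume J ≠ 0 := by
    rw [hJ, Real.volume_Ioo]; simp; positivity
  have hJ1 : volume J ≠ ∞ := by simp [hJ]
  have hB1 : volume (Metric.ball c.1 a) ≠ ∞ := measure_ball_lt_top.ne
  rw [setLAverage_eq] at hlt
  have h1 := ENNReal.mul_le_of_le_div hlt.le
  have hmeas : Measurable fun y => timeMaximalAbove f l (y, t) :=
    (measurable_timeMaximalAbove hf l).comp measurable_prodMk_right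
  have h2 : ∫⁻ w in cylinder c a b, f w ≤
      volume J * (2 * (l * volume (Metric.ball c.1 a) +
        ∫⁻ y in Metric.ball c.1 a, timeMaximalAbove f l (y, t))) := by
    rw [cylinder, Measure.volume_eq_prod, ← Measure.prod_restrict,
      lintegral_prod _ hf.aemeasurable]
    calc ∫⁻ y in Metric.ball c.1 a, ∫⁻ τ in J, f (y, τ)
        ≤ ∫⁻ y in Metric.ball c.1 a, volume J * (2 * (l + timeMaximalAbove f l (y, t))) := by
          refine lintegral_mono fun y => (setLIntegral_Ioo_le_timeMaximal f y hJt).trans ?_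
          gcongr
          exact timeMaximal_le_add f l _
      _ = _ := by
          rw [lintegral_const_mul' _ _ hJ1, lintegral_const_mul' _ _ (by norm_num),
            lintegral_add_left measurable_const, setLIntegral_const]
  have h3 := h1.trans h2
  rw [volume_cylinder_eq, ← hJ] at h3
  have h4 : (2 * volume J) * (l * volume (Metric.ball c.1 a) + l * volume (Metric.ball c.1 a)) ≤
      (2 * volume J) * (l * volume (Metric.ball c.1 a) +
        ∫⁻ y in Metric.ball c.1 a, timeMaximalAbove f l (y, t)) := by
    calc _ = 4 * l * (volume (Metric.ball c.1 a) * volume J) := by ring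
      _ ≤ _ := h3
      _ = _ := by ring
  rw [ENNReal.mul_le_mul_iff_right (by simp [hJ0]) (by finiteness)] at h4
  exact (ENNReal.add_le_add_iff_left (ENNReal.mul_ne_top hl' hB1)).1 h4

/-- If the strong maximal function of `f` exceeds `4 l` on a product `B × I`, then
`l ^ s |B × I|` is controlled by the integral of `f ^ s`. -/
theorem rpow_mul_volume_le_of_lt_strongMaximal (hn : 1 ≤ n) {f : SpaceTime n → ℝ≥0∞}
    (hf : Measurable f) {s : ℝ} (hs : 1 < s) {l : ℝ≥0∞} (hl : l ≠ 0) (hl' : l ≠ ∞)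
    {B : Set (EuclideanSpace ℝ (Fin n))} {I : Set ℝ} (hI : MeasurableSet I)
    (h : ∀ z ∈ B ×ˢ I, 4 * l < strongMaximal f z) :
    l ^ s * (volume B * volume I) ≤ strongConst n s * ∫⁻ z, f z ^ s := by
  have : Nontrivial (EuclideanSpace ℝ (Fin n)) := by
    have : Nonempty (Fin n) := ⟨⟨0, hn⟩⟩
    infer_instance
  have hG := measurable_timeMaximalAbove hf l
  have h1 : ∀ t ∈ I, l * volume B ≤
      ENNReal.ofReal (5 ^ n) * ∫⁻ x, timeMaximalAbove f l (x, t) := by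
    -- For fixed t in I the whole set B consists of bad points, so the product structure gives a
    -- lower bound with |B| on every slice.
    intro t ht
    have := mul_measure_le_of_forall_exists_ball volume
      (fun x => timeMaximalAbove f l (x, t)) l B
      (fun x hx => exists_ball_of_lt_strongMaximal hf hl' (h (x, t) ⟨hx, ht⟩))
    simpa using this
  have hls : l ^ (s - 1) ≠ ∞ := ENNReal.rpow_ne_top_of_nonneg (by linarith) hl'
  calc l ^ s * (volume B * volume I) = l ^ (s - 1) * ∫⁻ _ in I, l * volume B := by
        rw [setLIntegral_const]
        have e1 : l ^ s = l ^ (s - 1) * l := by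
          nth_rewrite 3 [← ENNReal.rpow_one l]
          rw [← ENNReal.rpow_add _ _ hl hl']; ring_nf
        rw [e1]; ring
    _ ≤ l ^ (s - 1) * ∫⁻ t in I, ENNReal.ofReal (5 ^ n) * ∫⁻ x, timeMaximalAbove f l (x, t) := by
        gcongr 1
        exact setLIntegral_mono' hI h1
    _ ≤ l ^ (s - 1) * ∫⁻ t, ENNReal.ofReal (5 ^ n) * ∫⁻ x, timeMaximalAbove f l (x, t) :=
        mul_le_mul' le_rfl (setLIntegral_le_lintegral _ _)
    _ = ENNReal.ofReal (5 ^ n) * ∫⁻ x, l ^ (s - 1) * ∫⁻ t, timeMaximalAbove f l (x, t) := by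
        rw [lintegral_const_mul' _ _ ENNReal.ofReal_ne_top, lintegral_const_mul' _ _ hls,
          lintegral_lintegral_swap (f := fun t x => timeMaximalAbove f l (x, t))
            (hG.comp measurable_swap).aemeasurable]
        ring
    _ ≤ ENNReal.ofReal (5 ^ n) * ∫⁻ x, timeConst s * ∫⁻ t, f (x, t) ^ s := by
        exact mul_le_mul' le_rfl
          (lintegral_mono fun x => lintegral_timeMaximalAbove_le hf x hs hl hl')
    _ = _ := by
        rw [lintegral_const_mul' _ _ (timeConst_ne_top hs), strongConst,
          Measure.volume_eq_prod, lintegral_prod _ (hf.pow_const s).aemeasurable]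
        ring

theorem strongMaximal_congr {f g : SpaceTime n → ℝ≥0∞} (h : f =ᵐ[volume] g) :
    strongMaximal f = strongMaximal g := by
  funext z
  have h' : ∀ S : Set (SpaceTime n), ⨍⁻ w in S, f w ∂volume = ⨍⁻ w in S, g w ∂volume :=
    fun S => laverage_congr (ae_restrict_of_ae h)
  simp only [strongMaximal, h']

/-- The version of `rpow_mul_volume_le_of_lt_strongMaximal` for almost everywhere measurable
functions. -/
theorem rpow_mul_volume_le_of_lt_strongMaximal₀ (hn : 1 ≤ n) {f : SpaceTime n → ℝ≥0∞}
    (hf : AEMeasurable f) {s : ℝ} (hs : 1 < s) {l : ℝ≥0∞} (hl : l ≠ 0) (hl' : l ≠ ∞)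
    {B : Set (EuclideanSpace ℝ (Fin n))} {I : Set ℝ} (hI : MeasurableSet I)
    (h : ∀ z ∈ B ×ˢ I, 4 * l < strongMaximal f z) :
    l ^ s * (volume B * volume I) ≤ strongConst n s * ∫⁻ z, f z ^ s := by
  rw [strongMaximal_congr hf.ae_eq_mk] at h
  refine (rpow_mul_volume_le_of_lt_strongMaximal hn hf.measurable_mk hs hl hl' hI h).trans_eq ?_
  congr 1
  refine lintegral_congr_ae ?_
  filter_upwards [hf.ae_eq_mk] with z hz
  rw [hz]

end Whitney

/-! ### Intrinsic metrics and cylinders -/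

namespace Whitney

variable {n : ℕ} {p : SpaceTime n → ℝ} {d lam : ℝ}

theorem locDist_comm (z a b : SpaceTime n) : locDist p d lam z a b = locDist p d lam z b a := by
  rw [locDist, locDist, dist_comm, abs_sub_comm]

theorem locDist_nonneg (z a b : SpaceTime n) : 0 ≤ locDist p d lam z a b :=
  le_max_of_le_right (Real.sqrt_nonneg _)

theorem sqrt_add_le_add_sqrt {x y : ℝ} (hx : 0 ≤ x) (hy : 0 ≤ y) :
    Real.sqrt (x + y) ≤ Real.sqrt x + Real.sqrt y := by
  rw [Real.sqrt_le_left (by positivity)]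
  nlinarith [Real.sq_sqrt hx, Real.sq_sqrt hy, Real.sqrt_nonneg x, Real.sqrt_nonneg y,
    mul_nonneg (Real.sqrt_nonneg x) (Real.sqrt_nonneg y)]

theorem locDist_triangle (hlam : 0 ≤ lam) (z a b c : SpaceTime n) :
    locDist p d lam z a c ≤ locDist p d lam z a b + locDist p d lam z b c := by
  refine max_le ?_ ?_
  · calc lam ^ (1 / p z - d / 2) * dist a.1 c.1
        ≤ lam ^ (1 / p z - d / 2) * (dist a.1 b.1 + dist b.1 c.1) :=
          mul_le_mul_of_nonneg_left (dist_triangle _ _ _) (Real.rpow_nonneg hlam _)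
      _ = lam ^ (1 / p z - d / 2) * dist a.1 b.1 + lam ^ (1 / p z - d / 2) * dist b.1 c.1 := by ring
      _ ≤ _ := add_le_add (le_max_left _ _) (le_max_left _ _)
  · have h := Real.rpow_nonneg hlam (1 - d)
    calc √(lam ^ (1 - d) * |a.2 - c.2|)
        ≤ √(lam ^ (1 - d) * |a.2 - b.2| + lam ^ (1 - d) * |b.2 - c.2|) := by
          refine Real.sqrt_le_sqrt ?_
          rw [← mul_add]
          exact mul_le_mul_of_nonneg_left (abs_sub_le _ _ _) h
      _ ≤ √(lam ^ (1 - d) * |a.2 - b.2|) + √(lam ^ (1 - d) * |b.2 - c.2|) :=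
          sqrt_add_le_add_sqrt (by positivity) (by positivity)
      _ ≤ _ := add_le_add (le_max_right _ _) (le_max_right _ _)

theorem scaleX_eq_inv (hlam : 0 < lam) (z : SpaceTime n) :
    scaleX p d lam z = (lam ^ (1 / p z - d / 2))⁻¹ := by
  rw [scaleX, ← Real.rpow_neg hlam.le]; ring_nf

theorem scaleX_pos (hlam : 0 < lam) (z : SpaceTime n) : 0 < scaleX p d lam z :=
  Real.rpow_pos_of_pos hlam _

theorem scaleT_eq_inv (hlam : 0 < lam) : scaleT d lam = (lam ^ (1 - d))⁻¹ := by
  rw [scaleT, ← Real.rpow_neg hlam.le]; ring_nf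

theorem scaleT_pos (hlam : 0 < lam) : 0 < scaleT d lam := Real.rpow_pos_of_pos hlam _

theorem mem_intrinsicCylinder_iff (hlam : 0 < lam) {z w : SpaceTime n} {r : ℝ} (hr : 0 < r) :
    w ∈ intrinsicCylinder p d lam z r ↔ locDist p d lam z z w < r := by
  have h1 : 0 < lam ^ (1 / p z - d / 2) := Real.rpow_pos_of_pos hlam _
  have h2 : 0 < lam ^ (1 - d) := Real.rpow_pos_of_pos hlam _
  have e1 : w.1 ∈ intrinsicBall p d lam z r ↔ lam ^ (1 / p z - d / 2) * dist z.1 w.1 < r := by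
    rw [intrinsicBall, Metric.mem_ball, scaleX_eq_inv hlam, dist_comm, lt_inv_mul_iff₀ h1]
  have e2 : w.2 ∈ intrinsicInterval d lam z r ↔ √(lam ^ (1 - d) * |z.2 - w.2|) < r := by
    rw [Real.sqrt_lt' hr, ← lt_inv_mul_iff₀ h2, ← scaleT_eq_inv hlam, abs_lt, intrinsicInterval,
      mem_Ioo]
    constructor <;> rintro ⟨h, h'⟩ <;> constructor <;> linarith
  rw [intrinsicCylinder, mem_prod, e1, e2, locDist, max_lt_iff]

/-- Only the spatial weight depends on the centre, and two such weights differ by a factor of at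
most λ^{|1/p(z)-1/p(w)|}. -/
theorem locDist_le_mul {Θ : ℝ} (hΘ : 1 ≤ Θ) (hlam : 1 ≤ lam) {z w : SpaceTime n}
    (h : lam ^ |1 / p z - 1 / p w| ≤ Θ) (a b : SpaceTime n) :
    locDist p d lam w a b ≤ Θ * locDist p d lam z a b := by
  have hlam0 : 0 < lam := by linarith
  refine max_le ?_ ?_
  · have h1 : lam ^ (1 / p w - d / 2) ≤ Θ * lam ^ (1 / p z - d / 2) := by
      calc lam ^ (1 / p w - d / 2)
          ≤ lam ^ (|1 / p z - 1 / p w| + (1 / p z - d / 2)) := by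
            refine Real.rpow_le_rpow_of_exponent_le hlam ?_
            have := neg_abs_le (1 / p z - 1 / p w)
            linarith
        _ = lam ^ |1 / p z - 1 / p w| * lam ^ (1 / p z - d / 2) := Real.rpow_add hlam0 _ _
        _ ≤ _ := by gcongr
    calc lam ^ (1 / p w - d / 2) * dist a.1 b.1
        ≤ Θ * (lam ^ (1 / p z - d / 2) * dist a.1 b.1) := by
          rw [← mul_assoc]; gcongr
      _ ≤ _ := mul_le_mul_of_nonneg_left (le_max_left _ _) (by linarith)
  · refine le_trans (le_max_right _ _) (le_mul_of_one_le_left (locDist_nonneg _ _ _) hΘ)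

theorem parDist_le_locDist (hlam : 1 ≤ lam) (hd : d ≤ 1) {z : SpaceTime n}
    (hz : 0 ≤ 1 / p z - d / 2) (a b : SpaceTime n) : parDist a b ≤ locDist p d lam z a b := by
  refine max_le_max ?_ (Real.sqrt_le_sqrt ?_)
  · exact le_mul_of_one_le_left dist_nonneg (Real.one_le_rpow hlam hz)
  · exact le_mul_of_one_le_left (abs_nonneg _) (Real.one_le_rpow hlam (by linarith))

theorem bddBelow_locDist_image (z : SpaceTime n) (E : Set (SpaceTime n)) :
    BddBelow (locDist p d lam z z '' E) :=
  ⟨0, by rintro _ ⟨v, -, rfl⟩; exact locDist_nonneg _ _ _⟩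

theorem distToSet_le {E : Set (SpaceTime n)} {z v : SpaceTime n} (hv : v ∈ E) :
    distToSet p d lam E z ≤ locDist p d lam z z v :=
  csInf_le (bddBelow_locDist_image z E) (mem_image_of_mem _ hv)

theorem exists_locDist_lt {E : Set (SpaceTime n)} (hE : E.Nonempty) {z : SpaceTime n} {r : ℝ}
    (h : distToSet p d lam E z < r) : ∃ v ∈ E, locDist p d lam z z v < r := by
  obtain ⟨_, ⟨v, hv, rfl⟩, hlt⟩ := exists_lt_of_csInf_lt (hE.image _) h
  exact ⟨v, hv, hlt⟩

theorem distToSet_pos {E : Set (SpaceTime n)} (hE : IsClosed E) (hne : E.Nonempty)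
    (hlam : 1 ≤ lam) (hd : d ≤ 1) {z : SpaceTime n} (hz : 0 ≤ 1 / p z - d / 2) (hzE : z ∉ E) :
    0 < distToSet p d lam E z := by
  obtain ⟨ε, hε, hball⟩ := Metric.isOpen_iff.1 hE.isOpen_compl z hzE
  refine lt_of_lt_of_le (lt_min hε (Real.sqrt_pos.2 hε)) (le_csInf (hne.image _) ?_)
  rintro _ ⟨v, hv, rfl⟩
  refine le_trans ?_ (parDist_le_locDist hlam hd hz z v)
  have h1 : ε ≤ dist z v := by
    by_contra! h
    exact hball (by rwa [Metric.mem_ball, dist_comm]) hv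
  rw [Prod.dist_eq] at h1
  rcases le_max_iff.1 h1 with h2 | h2
  · exact (min_le_left _ _).trans (h2.trans (le_max_left _ _))
  · refine (min_le_right _ _).trans (le_trans (Real.sqrt_le_sqrt ?_) (le_max_right _ _))
    rwa [Real.dist_eq] at h2

theorem subset_compl_of_le_distToSet (hlam : 0 < lam) {E : Set (SpaceTime n)} {z : SpaceTime n}
    {r : ℝ} (hr : 0 < r) (h : r ≤ distToSet p d lam E z) :
    intrinsicCylinder p d lam z r ⊆ Eᶜ := by
  intro v hv hvE
  rw [mem_intrinsicCylinder_iff hlam hr] at hv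
  linarith [distToSet_le (p := p) (d := d) (lam := lam) (z := z) hvE]

theorem volume_intrinsicBall (hlam : 0 < lam) (z : SpaceTime n) {r : ℝ} (hr : 0 < r) :
    volume (intrinsicBall p d lam z r) = ENNReal.ofReal ((scaleX p d lam z * r) ^ n) *
      volume (Metric.ball (0 : EuclideanSpace ℝ (Fin n)) 1) := by
  rw [intrinsicBall, Measure.addHaar_ball_of_pos _ _ (mul_pos (scaleX_pos hlam z) hr),
    finrank_euclideanSpace_fin]

theorem volume_intrinsicInterval (z : SpaceTime n) (r : ℝ) :
    volume (intrinsicInterval d lam z r) = ENNReal.ofReal (2 * (scaleT d lam * r ^ 2)) := by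
  rw [intrinsicInterval, Real.volume_Ioo]; ring_nf

theorem volume_intrinsicCylinder (z : SpaceTime n) (r : ℝ) :
    volume (intrinsicCylinder p d lam z r) =
      volume (intrinsicBall p d lam z r) * volume (intrinsicInterval d lam z r) := by
  rw [intrinsicCylinder, Measure.volume_eq_prod, Measure.prod_prod]

theorem volume_intrinsicCylinder_mul (hlam : 0 < lam) (z : SpaceTime n) {c r : ℝ} (hc : 0 < c)
    (hr : 0 < r) : volume (intrinsicCylinder p d lam z (c * r)) =
      ENNReal.ofReal (c ^ (n + 2)) * volume (intrinsicCylinder p d lam z r) := by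
  have hX := scaleX_pos (p := p) (d := d) hlam z
  rw [volume_intrinsicCylinder, volume_intrinsicCylinder, volume_intrinsicBall hlam z hr,
    volume_intrinsicBall hlam z (mul_pos hc hr), volume_intrinsicInterval,
    volume_intrinsicInterval]
  have e1 : (scaleX p d lam z * (c * r)) ^ n = c ^ n * (scaleX p d lam z * r) ^ n := by
    rw [← mul_pow]; ring
  have e2 : 2 * (scaleT d lam * (c * r) ^ 2) = c ^ 2 * (2 * (scaleT d lam * r ^ 2)) := by ring
  rw [e1, e2, pow_add, ENNReal.ofReal_mul (p := c ^ n) (by positivity),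
    ENNReal.ofReal_mul (p := c ^ 2) (by positivity),
    ENNReal.ofReal_mul (p := c ^ n) (by positivity)]
  ring

theorem isOpen_intrinsicCylinder (z : SpaceTime n) (r : ℝ) :
    IsOpen (intrinsicCylinder p d lam z r) := Metric.isOpen_ball.prod isOpen_Ioo

theorem scaleX_le_mul {Θ : ℝ} (hlam : 1 ≤ lam) {z w : SpaceTime n}
    (h : lam ^ |1 / p z - 1 / p w| ≤ Θ) : scaleX p d lam z ≤ Θ * scaleX p d lam w := by
  have hlam0 : 0 < lam := by linarith
  calc scaleX p d lam z ≤ lam ^ (|1 / p z - 1 / p w| + (-(1 / p w) + d / 2)) := by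
        refine Real.rpow_le_rpow_of_exponent_le hlam ?_
        have := neg_abs_le (1 / p z - 1 / p w)
        linarith
    _ = lam ^ |1 / p z - 1 / p w| * scaleX p d lam w := Real.rpow_add hlam0 _ _
    _ ≤ _ := by
      have := scaleX_pos (p := p) (d := d) hlam0 w
      gcongr

/-- The comparability constant of neighbouring cylinders. -/
noncomputable def compConst (n : ℕ) (Θ : ℝ) : ℝ := (2 * Θ ^ 2) ^ n * (4 * Θ ^ 2)

theorem compConst_pos (n : ℕ) {Θ : ℝ} (hΘ : 1 ≤ Θ) : 0 < compConst n Θ := by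
  unfold compConst; positivity

/-- The spatial radii differ by Θ from the scaling and by 2Θ from r, hence (2Θ²)^n. The time scaling
is the same at all centres, hence (2Θ)² for the intervals. -/
theorem volume_comparable {Θ : ℝ} (hΘ : 1 ≤ Θ) (hlam : 1 ≤ lam) {z w : SpaceTime n}
    (h : lam ^ |1 / p z - 1 / p w| ≤ Θ) {r r' : ℝ} (hr : 0 < r) (hr' : 0 < r')
    (hrr : r ≤ 2 * Θ * r') :
    volume (intrinsicBall p d lam z r) ≤
      ENNReal.ofReal (compConst n Θ) * volume (intrinsicBall p d lam w r') ∧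
    volume (intrinsicInterval d lam z r) ≤
      ENNReal.ofReal (compConst n Θ) * volume (intrinsicInterval d lam w r') ∧
    volume (intrinsicCylinder p d lam z r) ≤
      ENNReal.ofReal (compConst n Θ) * volume (intrinsicCylinder p d lam w r') := by
  have hlam0 : 0 < lam := by linarith
  have hX := scaleX_pos (p := p) (d := d) hlam0 z
  have hX' := scaleX_pos (p := p) (d := d) hlam0 w
  have hT := scaleT_pos (d := d) hlam0
  have hΘ2 : 1 ≤ Θ ^ 2 := one_le_pow₀ hΘ
  have hA : 1 ≤ (2 * Θ ^ 2) ^ n := one_le_pow₀ (by linarith)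
  have h1 : volume (intrinsicBall p d lam z r) ≤
      ENNReal.ofReal ((2 * Θ ^ 2) ^ n) * volume (intrinsicBall p d lam w r') := by
    rw [volume_intrinsicBall hlam0 z hr, volume_intrinsicBall hlam0 w hr', ← mul_assoc,
      ← ENNReal.ofReal_mul (by positivity), ← mul_pow]
    refine mul_le_mul' (ENNReal.ofReal_le_ofReal (pow_le_pow_left₀ (by positivity) ?_ n)) le_rfl
    calc scaleX p d lam z * r ≤ (Θ * scaleX p d lam w) * (2 * Θ * r') := by
          gcongr; exact scaleX_le_mul hlam h
      _ = _ := by ring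
  have h2 : volume (intrinsicInterval d lam z r) ≤
      ENNReal.ofReal (4 * Θ ^ 2) * volume (intrinsicInterval d lam w r') := by
    rw [volume_intrinsicInterval, volume_intrinsicInterval, ← ENNReal.ofReal_mul (by positivity)]
    refine ENNReal.ofReal_le_ofReal ?_
    calc 2 * (scaleT d lam * r ^ 2) ≤ 2 * (scaleT d lam * (2 * Θ * r') ^ 2) := by gcongr
      _ = _ := by ring
  refine ⟨h1.trans ?_, h2.trans ?_, ?_⟩
  · gcongr
    exact le_mul_of_one_le_right (by positivity) (by linarith)
  · gcongr
    exact le_mul_of_one_le_left (by positivity) hA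
  · rw [volume_intrinsicCylinder, volume_intrinsicCylinder, compConst,
      ENNReal.ofReal_mul (by positivity)]
    calc _ ≤ _ := mul_le_mul' h1 h2
      _ = _ := by ring

/-! ### Neighbouring cylinders and the Whitney covering -/

/-- The enlargement constant `ĉ` of the Whitney covering. -/
noncomputable def enlargeConst (Θ : ℝ) : ℝ := 2 + 8 * Θ ^ 2

theorem ten_le_enlargeConst {Θ : ℝ} (hΘ : 1 ≤ Θ) : 10 ≤ enlargeConst Θ := by
  have : 1 ≤ Θ ^ 2 := one_le_pow₀ hΘ
  unfold enlargeConst; linarith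

/-- The exponent is locally comparable at the scale of the distance to `E`. -/
structure IsComparable (p : SpaceTime n → ℝ) (d lam Θ : ℝ) (Q E : Set (SpaceTime n)) : Prop where
  one_le : 1 ≤ Θ
  one_le_lam : 1 ≤ lam
  le_one : d ≤ 1
  exp_nonneg : ∀ z ∈ Q, 0 ≤ 1 / p z - d / 2
  exp_le_one : ∀ z ∈ Q, 1 / p z - d / 2 ≤ 1
  bounded : Bornology.IsBounded Q
  closed : IsClosed E
  nonempty : E.Nonempty
  comparable : ∀ z ∈ Q \ E, ∀ w ∈ Q \ E,
    parDist z w ≤ max (distToSet p d lam E z) (distToSet p d lam E w) →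
      lam ^ |1 / p z - 1 / p w| ≤ Θ

namespace IsComparable

variable {Θ : ℝ} {Q E : Set (SpaceTime n)} {z w : SpaceTime n}

theorem distToSet_pos (h : IsComparable p d lam Θ Q E) (hz : z ∈ Q \ E) :
    0 < distToSet p d lam E z :=
  Whitney.distToSet_pos h.closed h.nonempty h.one_le_lam h.le_one (h.exp_nonneg z hz.1) hz.2

/-- Through a common point, `parDist z w` ≤ 2δ(ρ_z + ρ_w) ≤ 4δ max(ρ_z, ρ_w), which is below the
maximum as δ ≤ 1/40. -/
theorem rpow_le_of_inter (h : IsComparable p d lam Θ Q E) (hz : z ∈ Q \ E) (hw : w ∈ Q \ E)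
    {δ : ℝ} (hδ : 0 < δ) (hδ' : δ ≤ 1 / 40)
    (hi : (intrinsicCylinder p d lam z (2 * (δ * distToSet p d lam E z)) ∩
      intrinsicCylinder p d lam w (2 * (δ * distToSet p d lam E w))).Nonempty) :
    lam ^ |1 / p z - 1 / p w| ≤ Θ := by
  have hlam0 : 0 < lam := by linarith [h.one_le_lam]
  have hρz := h.distToSet_pos hz
  have hρw := h.distToSet_pos hw
  refine h.comparable z hz w hw ?_
  obtain ⟨y, hyz, hyw⟩ := hi
  rw [mem_intrinsicCylinder_iff hlam0 (by positivity)] at hyz hyw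
  have tri : parDist z w ≤ parDist z y + parDist y w := by
    refine max_le ((dist_triangle _ y.1 _).trans (add_le_add (le_max_left _ _) (le_max_left _ _)))
      (le_trans ?_ (add_le_add (le_max_right _ _) (le_max_right _ _)))
    exact (Real.sqrt_le_sqrt (abs_sub_le _ y.2 _)).trans
      (sqrt_add_le_add_sqrt (abs_nonneg _) (abs_nonneg _))
  have h1 := parDist_le_locDist h.one_le_lam h.le_one (h.exp_nonneg z hz.1) z y
  have h2 := parDist_le_locDist h.one_le_lam h.le_one (h.exp_nonneg w hw.1) y w
  rw [locDist_comm] at h2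
  have h3 := le_max_left (distToSet p d lam E z) (distToSet p d lam E w)
  have h4 := le_max_right (distToSet p d lam E z) (distToSet p d lam E w)
  nlinarith

/-- If ρ_w > 2Θρ_z, some v in E is nearer to z than ρ_w/(2Θ). Passing from w to the common point, to
z and to v costs at most (2δ + δ + 1/2)ρ_w < ρ_w in the metric of w, a contradiction. -/
theorem distToSet_le_mul (h : IsComparable p d lam Θ Q E) (hz : z ∈ Q \ E) (hw : w ∈ Q \ E)
    {δ : ℝ} (hδ : 0 < δ) (hδ' : δ ≤ 1 / 40)
    (hi : (intrinsicCylinder p d lam z (2 * (δ * distToSet p d lam E z)) ∩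
      intrinsicCylinder p d lam w (2 * (δ * distToSet p d lam E w))).Nonempty) :
    distToSet p d lam E w ≤ 2 * Θ * distToSet p d lam E z := by
  have hlam0 : 0 < lam := by linarith [h.one_le_lam]
  have hρz := h.distToSet_pos hz
  have hρw := h.distToSet_pos hw
  have hΘ := h.one_le
  have hcomp := h.rpow_le_of_inter hz hw hδ hδ' hi
  obtain ⟨y, hyz, hyw⟩ := hi
  rw [mem_intrinsicCylinder_iff hlam0 (by positivity)] at hyz hyw
  by_contra! hlt
  have hlt' : distToSet p d lam E z < distToSet p d lam E w / (2 * Θ) := by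
    rw [lt_div_iff₀ (by positivity)]; linarith
  obtain ⟨v, hv, hvlt⟩ := exists_locDist_lt h.nonempty hlt'
  have h1 := distToSet_le (p := p) (d := d) (lam := lam) (z := w) hv
  have h2 := locDist_triangle (p := p) (d := d) hlam0.le w w y v
  have h3 := locDist_triangle (p := p) (d := d) hlam0.le w y z v
  have h4 := locDist_le_mul (d := d) hΘ h.one_le_lam hcomp y z
  have h5 := locDist_le_mul (d := d) hΘ h.one_le_lam hcomp z v
  rw [locDist_comm] at hyz
  have h6 : Θ * locDist p d lam z z v ≤ distToSet p d lam E w / 2 := by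
    calc _ ≤ Θ * (distToSet p d lam E w / (2 * Θ)) := by gcongr
      _ = _ := by field_simp
  have h7 : Θ * locDist p d lam z y z ≤ δ * distToSet p d lam E w := by
    calc Θ * locDist p d lam z y z ≤ Θ * (2 * (δ * distToSet p d lam E z)) := by gcongr
      _ = δ * (2 * Θ * distToSet p d lam E z) := by ring
      _ ≤ _ := by gcongr
  nlinarith

/-- The path from w through the common point and z adds two steps of length 2δρ_z, each multiplied
by Θ; with ρ_z ≤ 2Θρ_w this is the 8Θ² in `enlargeConst`. -/
theorem subset_enlarged (h : IsComparable p d lam Θ Q E) (hz : z ∈ Q \ E) (hw : w ∈ Q \ E)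
    {δ : ℝ} (hδ : 0 < δ) (hδ' : δ ≤ 1 / 40)
    (hi : (intrinsicCylinder p d lam z (2 * (δ * distToSet p d lam E z)) ∩
      intrinsicCylinder p d lam w (2 * (δ * distToSet p d lam E w))).Nonempty) :
    intrinsicCylinder p d lam z (2 * (δ * distToSet p d lam E z)) ⊆
      intrinsicCylinder p d lam w (enlargeConst Θ * (δ * distToSet p d lam E w)) := by
  have hlam0 : 0 < lam := by linarith [h.one_le_lam]
  have hρz := h.distToSet_pos hz
  have hρw := h.distToSet_pos hw
  have hΘ := h.one_le
  have hc := ten_le_enlargeConst hΘ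
  have hcomp := h.rpow_le_of_inter hz hw hδ hδ' hi
  have hle := h.distToSet_le_mul hw hz hδ hδ' (by rwa [inter_comm])
  obtain ⟨y, hyz, hyw⟩ := hi
  intro a ha
  rw [mem_intrinsicCylinder_iff hlam0 (by positivity)] at hyz hyw ha ⊢
  have h2 := locDist_triangle (p := p) (d := d) hlam0.le w w y a
  have h3 := locDist_triangle (p := p) (d := d) hlam0.le w y z a
  have h4 := locDist_le_mul (d := d) hΘ h.one_le_lam hcomp y z
  have h5 := locDist_le_mul (d := d) hΘ h.one_le_lam hcomp z a
  rw [locDist_comm] at hyz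
  have key : ∀ x, x ≤ 2 * (δ * distToSet p d lam E z) →
      Θ * x ≤ 4 * Θ ^ 2 * (δ * distToSet p d lam E w) := by
    intro x hx
    calc Θ * x ≤ Θ * (2 * (δ * (2 * Θ * distToSet p d lam E w))) := by
          gcongr; exact hx.trans (by gcongr)
      _ = _ := by ring
  have h6 := key _ hyz.le
  have h7 := key _ ha.le
  have h8 : enlargeConst Θ * (δ * distToSet p d lam E w) =
    2 * (δ * distToSet p d lam E w) + 8 * Θ ^ 2 * (δ * distToSet p d lam E w) := by
    rw [enlargeConst]; ring
  rw [h8]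
  linarith

/-- Supplies the bound on the radii required by Vitali's lemma. -/
theorem exists_distToSet_le (h : IsComparable p d lam Θ Q E) :
    ∃ R, ∀ z ∈ Q \ E, distToSet p d lam E z ≤ R := by
  obtain ⟨v, hv⟩ := h.nonempty
  have hlam0 : 0 < lam := by linarith [h.one_le_lam]
  obtain ⟨D, hD⟩ := h.bounded.subset_closedBall v
  refine ⟨max (lam * D) (√(lam ^ (1 - d) * D)), fun z hz => (distToSet_le hv).trans ?_⟩
  have hzD : dist z v ≤ D := hD hz.1
  rw [Prod.dist_eq, max_le_iff] at hzD
  refine max_le_max ?_ (Real.sqrt_le_sqrt ?_)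
  · refine mul_le_mul ?_ hzD.1 dist_nonneg hlam0.le
    calc lam ^ (1 / p z - d / 2) ≤ lam ^ (1 : ℝ) :=
          Real.rpow_le_rpow_of_exponent_le h.one_le_lam (h.exp_le_one z hz.1)
      _ = lam := Real.rpow_one _
  · refine mul_le_mul_of_nonneg_left ?_ (Real.rpow_nonneg hlam0.le _)
    rw [← Real.dist_eq]; exact hzD.2

end IsComparable

/-- The overlap constant of the Whitney covering. -/
noncomputable def overlapConst (n : ℕ) (Θ : ℝ) : ℝ :=
  (enlargeConst Θ * (9 * Θ)) ^ (n + 2) * compConst n Θ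

theorem IsComparable.exists_isWhitneyCovering {Θ : ℝ} {Q E : Set (SpaceTime n)}
    (h : IsComparable p d lam Θ Q E) :
    ∃ Z, IsWhitneyCovering p d lam Q E (9 * Θ) (enlargeConst Θ) (compConst n Θ)
      ⌈overlapConst n Θ⌉₊ Z := by
  have hlam0 : 0 < lam := by linarith [h.one_le_lam]
  have hΘ := h.one_le
  have hΘ0 : 0 < Θ := by linarith
  set ch := enlargeConst Θ with hch
  have hc : 10 ≤ ch := ten_le_enlargeConst hΘ
  have hc0 : 0 < ch := by linarith
  set δ := 1 / (4 * ch) with hδdef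
  have hδ : 0 < δ := by positivity
  have hδ' : δ ≤ 1 / 40 := one_div_le_one_div_of_le (by norm_num) (by linarith)
  have hδc : ch * δ = 1 / 4 := by rw [hδdef]; field_simp
  set ρ := distToSet p d lam E with hρ
  have hρpos : ∀ z ∈ Q \ E, 0 < ρ z := fun z hz => h.distToSet_pos hz
  obtain ⟨R, hR⟩ := h.exists_distToSet_le
  have hself : ∀ z r, 0 < r → z ∈ intrinsicCylinder p d lam z r := by
    intro z r hr
    rw [mem_intrinsicCylinder_iff hlam0 hr, locDist]
    simpa using hr
  have hmono : ∀ z r r', 0 < r → r ≤ r' →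
      intrinsicCylinder p d lam z r ⊆ intrinsicCylinder p d lam z r' := by
    intro z r r' hr hrr a ha
    rw [mem_intrinsicCylinder_iff hlam0 (by linarith)]
    rw [mem_intrinsicCylinder_iff hlam0 hr] at ha
    linarith
  have hX0 : 0 < δ / (9 * Θ) := by positivity
  have hXle : δ / (9 * Θ) ≤ δ := div_le_self hδ.le (by linarith)
  have hsmall : ∀ z ∈ Q \ E, intrinsicCylinder p d lam z (δ / (9 * Θ) * ρ z) ⊆
      intrinsicCylinder p d lam z (2 * (δ * ρ z)) := by
    intro z hz
    have := hρpos z hz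
    refine hmono z _ _ (by positivity) ?_
    nlinarith [mul_pos hδ this]
  obtain ⟨Z, hZ, hdisj, hcov⟩ := Vitali.exists_disjoint_subfamily_covering_enlargement
    (fun z => intrinsicCylinder p d lam z (δ / (9 * Θ) * ρ z)) (Q \ E) ρ 2 one_lt_two
    (fun z hz => (hρpos z hz).le) R hR
    (fun z hz => ⟨z, hself z _ (mul_pos hX0 (hρpos z hz))⟩)
  have hcount : Z.Countable := hdisj.countable_of_isOpen
    (fun _ _ => isOpen_intrinsicCylinder _ _)
    (fun z hz => ⟨z, hself z _ (mul_pos hX0 (hρpos z (hZ hz)))⟩)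
  refine ⟨Z, hcount, hZ, hdisj, ?_, ?_, ?_, ?_, ?_, ?_⟩
  -- Vitali's selection gives ρ_z ≤ 2ρ_w. With X = 9Θ the distance from w to z, measured at w, is at
  -- most (1/9 + 2/9)δρ_w.
  · intro z hz
    obtain ⟨w, hw, ⟨y, hyz, hyw⟩, hle⟩ := hcov z hz
    have hcomp := h.rpow_le_of_inter hz (hZ hw) hδ hδ'
      ⟨y, hsmall z hz hyz, hsmall w (hZ hw) hyw⟩
    refine mem_iUnion₂.2 ⟨w, hw, ?_⟩
    have h1 := hρpos z hz
    have h2 := hρpos w (hZ hw)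
    rw [mem_intrinsicCylinder_iff hlam0 (by positivity)] at hyz hyw ⊢
    have h3 := locDist_triangle (p := p) (d := d) hlam0.le w w y z
    have h4 := locDist_le_mul (d := d) hΘ h.one_le_lam hcomp y z
    rw [locDist_comm z z y] at hyz
    have h5 : Θ * locDist p d lam z y z ≤ 2 / 9 * (δ * ρ w) := by
      calc Θ * locDist p d lam z y z ≤ Θ * (δ / (9 * Θ) * (2 * ρ w)) := by
            gcongr; exact hyz.le.trans (by gcongr)
        _ = _ := by field_simp
    have h6 : δ / (9 * Θ) * ρ w ≤ 1 / 9 * (δ * ρ w) := by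
      rw [div_mul_eq_mul_div, div_le_iff₀ (by positivity)]
      have : δ * ρ w ≤ Θ * (δ * ρ w) := le_mul_of_one_le_left (by positivity) hΘ
      linarith
    have := mul_pos hδ h2
    linarith
  -- Volume count: the shrunken cylinders of all members containing w in their doubles are disjoint,
  -- lie in ĉ times one fixed member, and each has volume at least a fixed fraction of it.
  · intro w hw
    set S := {z ∈ Z | w ∈ intrinsicCylinder p d lam z (2 * (δ * ρ z))} with hS
    rcases S.eq_empty_or_nonempty with hSe | ⟨z₁, hz₁⟩
    · rw [hSe, encard_empty]; exact zero_le
    have hSZ : S ⊆ Z := fun z hz => hz.1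
    have hz₁Q := hZ hz₁.1
    have hρ₁ := hρpos z₁ hz₁Q
    set V := volume (intrinsicCylinder p d lam z₁ (ch * (δ * ρ z₁))) with hV
    have hV0 : V ≠ 0 := ((isOpen_intrinsicCylinder _ _).measure_pos _
      ⟨z₁, hself _ _ (by positivity)⟩).ne'
    have hV1 : V ≠ ∞ := by
      rw [hV, volume_intrinsicCylinder]
      exact ENNReal.mul_ne_top measure_ball_lt_top.ne (by
        rw [volume_intrinsicInterval]; exact ENNReal.ofReal_ne_top)
    have hle : ∀ z ∈ S, V ≤ ENNReal.ofReal (overlapConst n Θ) *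
        volume (intrinsicCylinder p d lam z (δ / (9 * Θ) * ρ z)) := by
      intro z hz
      have hzQ := hZ hz.1
      have hρz := hρpos z hzQ
      have hi : (intrinsicCylinder p d lam z₁ (2 * (δ * ρ z₁)) ∩
        intrinsicCylinder p d lam z (2 * (δ * ρ z))).Nonempty := ⟨w, hz₁.2, hz.2⟩
      have h1 := h.rpow_le_of_inter hz₁Q hzQ hδ hδ' hi
      have h2 := h.distToSet_le_mul hzQ hz₁Q hδ hδ' (by rwa [inter_comm])
      have h3 := (volume_comparable (d := d) hΘ h.one_le_lam h1 (mul_pos hX0 hρ₁) (mul_pos hX0 hρz)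
        (by calc δ / (9 * Θ) * ρ z₁ ≤ δ / (9 * Θ) * (2 * Θ * ρ z) := by gcongr
              _ = _ := by ring)).2.2
      have e : ch * (δ * ρ z₁) = (ch * (9 * Θ)) * (δ / (9 * Θ) * ρ z₁) := by field_simp
      rw [hV, e, volume_intrinsicCylinder_mul hlam0 z₁ (by positivity) (mul_pos hX0 hρ₁),
        overlapConst, ENNReal.ofReal_mul (by positivity), mul_assoc]
      gcongr
    have hsub : (⋃ z : S, intrinsicCylinder p d lam z (δ / (9 * Θ) * ρ z)) ⊆
        intrinsicCylinder p d lam z₁ (ch * (δ * ρ z₁)) := by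
      refine iUnion_subset fun z => ?_
      have hzQ := hZ z.2.1
      exact (hsmall z hzQ).trans (h.subset_enlarged hzQ hz₁Q hδ hδ' ⟨w, z.2.2, hz₁.2⟩)
    have : Countable S := (hcount.mono hSZ).to_subtype
    have hsum : (S.encard : ℝ≥0∞) * V ≤ ENNReal.ofReal (overlapConst n Θ) * V := by
      calc (S.encard : ℝ≥0∞) * V = ∑' _ : S, V := (ENNReal.tsum_set_const S V).symm
        _ ≤ ∑' z : S, ENNReal.ofReal (overlapConst n Θ) *
            volume (intrinsicCylinder p d lam z (δ / (9 * Θ) * ρ z)) :=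
          ENNReal.tsum_le_tsum fun z => hle z z.2
        _ = ENNReal.ofReal (overlapConst n Θ) *
            ∑' z : S, volume (intrinsicCylinder p d lam z (δ / (9 * Θ) * ρ z)) :=
          ENNReal.tsum_mul_left
        _ ≤ _ := by
          gcongr
          refine (tsum_meas_le_meas_iUnion_of_disjoint volume
            (fun z => (isOpen_intrinsicCylinder _ _).measurableSet) ?_).trans (measure_mono hsub)
          exact (hdisj.subset hSZ).subtype _ _
    have hfin := (ENNReal.mul_le_mul_iff_left hV0 hV1).1 hsum
    have h4 : (S.encard : ℝ≥0∞) ≤ ((⌈overlapConst n Θ⌉₊ : ℕ) : ℝ≥0∞) := by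
      refine hfin.trans ?_
      rw [← ENNReal.ofReal_natCast]
      exact ENNReal.ofReal_le_ofReal (Nat.le_ceil _)
    exact_mod_cast h4
  · intro z hz w hw hi
    have h1 := h.rpow_le_of_inter (hZ hz) (hZ hw) hδ hδ' hi
    have h2 := h.distToSet_le_mul (hZ hw) (hZ hz) hδ hδ' (by rwa [inter_comm])
    exact volume_comparable hΘ h.one_le_lam h1 (mul_pos hδ (hρpos z (hZ hz)))
      (mul_pos hδ (hρpos w (hZ hw)))
      (by calc δ * ρ z ≤ δ * (2 * Θ * ρ w) := by gcongr
            _ = _ := by ring)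
  · intro z hz
    have := hρpos z (hZ hz)
    refine subset_compl_of_le_distToSet hlam0 (by positivity) ?_
    rw [← mul_assoc, hδc]; linarith
  · intro z hz
    have := hρpos z (hZ hz)
    have e : 8 * ch * (δ * ρ z) = 2 * ρ z := by
      calc _ = 8 * (ch * δ) * ρ z := by ring
        _ = _ := by rw [hδc]; ring
    rw [e]
    obtain ⟨v, hv, hlt⟩ := exists_locDist_lt h.nonempty (show ρ z < 2 * ρ z by linarith)
    exact ⟨v, (mem_intrinsicCylinder_iff hlam0 (by linarith)).2 hlt, hv⟩
  · intro z hz w hw hi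
    exact h.subset_enlarged (hZ hz) (hZ hw) hδ hδ' hi

end Whitney

/-! ### The good set and the regularity of the exponent -/

namespace Whitney

variable {n : ℕ}

theorem isOpen_lt_strongMaximal (f : SpaceTime n → ℝ≥0∞) (c : ℝ≥0∞) :
    IsOpen {z | c < strongMaximal f z} := by
  rw [isOpen_iff_mem_nhds]
  intro z (hz : c < strongMaximal f z)
  simp only [strongMaximal, lt_iSup_iff] at hz
  obtain ⟨y, a, b, ha, hb, hmem, hlt⟩ := hz
  have hopen : IsOpen (cylinder y a b) := Metric.isOpen_ball.prod isOpen_Ioo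
  filter_upwards [hopen.mem_nhds hmem] with w hw
  simp only [strongMaximal, lt_iSup_iff]
  exact ⟨y, a, b, ha, hb, hw, hlt⟩

theorem continuous_parDist_left (z : SpaceTime n) : Continuous fun w => parDist w z := by
  unfold parDist
  fun_prop

theorem IsLogHolder.continuous {pm pp L : ℝ} {p : SpaceTime n → ℝ} {om : ℝ → ℝ}
    (h : IsLogHolder pm pp L p om) : Continuous p := by
  -- The limit is taken from the right only; continuity on [0, ∞) identifies it with the value at 0.
  have h0 : om 0 = 0 := by
    have h1 : Tendsto om (𝓝[>] 0) (𝓝 (om 0)) :=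
      (h.cont 0 self_mem_Ici).mono_left (nhdsWithin_mono _ Ioi_subset_Ici_self)
    exact tendsto_nhds_unique h1 h.tendsto_zero
  rw [continuous_iff_continuousAt]
  intro z
  have h2 : Tendsto (fun w => parDist w z) (𝓝 z) (𝓝[≥] 0) := by
    refine tendsto_nhdsWithin_iff.2 ⟨?_, Eventually.of_forall fun w => ?_⟩
    · have := (continuous_parDist_left z).tendsto z
      simpa [parDist] using this
    · exact le_max_of_le_right (Real.sqrt_nonneg _)
  have h3 : Tendsto (fun w => om (parDist w z)) (𝓝 z) (𝓝 0) := by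
    have := (h.cont 0 self_mem_Ici).tendsto.comp h2
    rwa [h0] at this
  rw [ContinuousAt, tendsto_iff_dist_tendsto_zero]
  exact squeeze_zero (fun _ => dist_nonneg) (fun w => by
    rw [Real.dist_eq]; exact h.modulus w z) h3

/-- The function whose maximal function defines the good set. -/
noncomputable def truncatedFun (p : SpaceTime n → ℝ) (d q : ℝ)
    (Ω : Set (EuclideanSpace ℝ (Fin n))) (T : ℝ) (u : SpaceTime n → ℝ)
    (Du : SpaceTime n → EuclideanSpace ℝ (Fin n)) (α₀ : ℝ) (z₀ : SpaceTime n) (ρ ρb : ℝ) :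
    SpaceTime n → ℝ≥0∞ :=
  (intrinsicCylinder p d α₀ z₀ ρb).indicator fun w =>
    ENNReal.ofReal
      ((‖zeroExt Ω T Du w‖ + 1 + |zeroExt Ω T u w| / (scaleX p d α₀ z₀ * ρ)) ^ (p w / q))

theorem goodSet_eq {p : SpaceTime n → ℝ} {d q β : ℝ} {Ω : Set (EuclideanSpace ℝ (Fin n))} {T : ℝ}
    {u : SpaceTime n → ℝ} {Du : SpaceTime n → EuclideanSpace ℝ (Fin n)} {α₀ : ℝ}
    {z₀ : SpaceTime n} {ρ ρb lam : ℝ} (hq : 0 < q) (hβ : β < 1) (hlam : 0 < lam) :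
    goodSet p d q β Ω T u Du α₀ z₀ ρ ρb lam =
      {z | strongMaximal (truncatedFun p d q Ω T u Du α₀ z₀ ρ ρb) z ≤
        ENNReal.ofReal (lam ^ (1 / q))} := by
  have hs : 0 < q * (1 - β) := mul_pos hq (by linarith)
  have e : ENNReal.ofReal (lam ^ (1 - β)) =
      ENNReal.ofReal (lam ^ (1 / q)) ^ (q * (1 - β)) := by
    rw [ENNReal.ofReal_rpow_of_pos (Real.rpow_pos_of_pos hlam _), ← Real.rpow_mul hlam.le]
    congr 2
    field_simp
  ext z
  simp only [goodSet, mem_ofPred_eq]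
  rw [e]
  exact ENNReal.rpow_le_rpow_iff hs

theorem isClosed_goodSet {p : SpaceTime n → ℝ} {d q β : ℝ} {Ω : Set (EuclideanSpace ℝ (Fin n))}
    {T : ℝ} {u : SpaceTime n → ℝ} {Du : SpaceTime n → EuclideanSpace ℝ (Fin n)} {α₀ : ℝ}
    {z₀ : SpaceTime n} {ρ ρb lam : ℝ} (hq : 0 < q) (hβ : β < 1) (hlam : 0 < lam) :
    IsClosed (goodSet p d q β Ω T u Du α₀ z₀ ρ ρb lam) := by
  rw [goodSet_eq hq hβ hlam, ← isOpen_compl_iff]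
  convert isOpen_lt_strongMaximal (truncatedFun p d q Ω T u Du α₀ z₀ ρ ρb)
    (ENNReal.ofReal (lam ^ (1 / q))) using 1
  ext z
  simp

/-! ### Power bounds for α₀ and λ -/

/-- The volume of the unit ball. -/
noncomputable def unitVol (n : ℕ) : ℝ :=
  (volume (Metric.ball (0 : EuclideanSpace ℝ (Fin n)) 1)).toReal

theorem unitVol_pos (n : ℕ) : 0 < unitVol n :=
  ENNReal.toReal_pos (Metric.measure_ball_pos _ _ one_pos).ne' measure_ball_lt_top.ne

theorem ofReal_unitVol (n : ℕ) : ENNReal.ofReal (unitVol n) =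
    volume (Metric.ball (0 : EuclideanSpace ℝ (Fin n)) 1) :=
  ENNReal.ofReal_toReal measure_ball_lt_top.ne

theorem volume_intrinsicCylinder_eq_ofReal {p : SpaceTime n → ℝ} {d μ : ℝ} (hμ : 0 < μ)
    (z : SpaceTime n) {r : ℝ} (hr : 0 < r) : volume (intrinsicCylinder p d μ z r) =
      ENNReal.ofReal (2 * unitVol n * (scaleX p d μ z ^ n * scaleT d μ) * r ^ (n + 2)) := by
  have hX := scaleX_pos (p := p) (d := d) hμ z
  have hT := scaleT_pos (d := d) hμ
  have hω := unitVol_pos n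
  rw [volume_intrinsicCylinder, volume_intrinsicBall hμ z hr, volume_intrinsicInterval,
    ← ofReal_unitVol, ← ENNReal.ofReal_mul (by positivity), ← ENNReal.ofReal_mul (by positivity)]
  congr 1
  ring

/-- The exponent on the right is d(n+2)/2 - n/p(z) - b ≥ 2β₀ - b ≥ β₀. It is used with b = β at
level α₀ and b = β₀ at level λ. -/
theorem rpow_le_rpow_mul_scale {p : SpaceTime n → ℝ} {d μ b β₀ P : ℝ} {z : SpaceTime n}
    (hμ : 1 ≤ μ) (hb : b ≤ β₀) (hP : 0 < P) (hPz : P ≤ p z)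
    (hd : 2 * β₀ ≤ d * (n + 2) / 2 - n / P) :
    μ ^ β₀ ≤ μ ^ (1 - b) * (scaleX p d μ z ^ n * scaleT d μ) := by
  have hμ0 : 0 < μ := by linarith
  have h1 : (n : ℝ) / p z ≤ n / P := by gcongr
  rw [scaleX, scaleT, ← Real.rpow_natCast, ← Real.rpow_mul hμ0.le, ← Real.rpow_add hμ0,
    ← Real.rpow_add hμ0]
  refine Real.rpow_le_rpow_of_exponent_le hμ ?_
  have e : (-(1 / p z) + d / 2) * (n : ℝ) = - (n / p z) + d * n / 2 := by ring
  rw [e]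
  linarith

theorem ofReal_le_rpow_mul_volume {p : SpaceTime n → ℝ} {d μ b β₀ P : ℝ} {z : SpaceTime n}
    (hμ : 1 ≤ μ) (hb : b ≤ β₀) (hP : 0 < P) (hPz : P ≤ p z)
    (hd : 2 * β₀ ≤ d * (n + 2) / 2 - n / P) {r : ℝ} (hr : 0 < r) :
    ENNReal.ofReal (2 * unitVol n * (μ ^ β₀ * r ^ (n + 2))) ≤
      ENNReal.ofReal (μ ^ (1 - b)) * volume (intrinsicCylinder p d μ z r) := by
  have hμ0 : 0 < μ := by linarith
  have hω := unitVol_pos n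
  rw [volume_intrinsicCylinder_eq_ofReal hμ0 z hr, ← ENNReal.ofReal_mul (by positivity)]
  refine ENNReal.ofReal_le_ofReal ?_
  calc 2 * unitVol n * (μ ^ β₀ * r ^ (n + 2))
      ≤ 2 * unitVol n * ((μ ^ (1 - b) * (scaleX p d μ z ^ n * scaleT d μ)) * r ^ (n + 2)) := by
        gcongr; exact rpow_le_rpow_mul_scale hμ hb hP hPz hd
    _ = _ := by ring

theorem setLIntegral_zeroExt_le {p : SpaceTime n → ℝ} {β : ℝ}
    {Ω : Set (EuclideanSpace ℝ (Fin n))} (hΩ : IsOpen Ω) (T : ℝ) (u : SpaceTime n → ℝ)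
    (Du : SpaceTime n → EuclideanSpace ℝ (Fin n)) (S : Set (SpaceTime n)) :
    ∫⁻ z in S, ENNReal.ofReal
      ((|zeroExt Ω T u z| + ‖zeroExt Ω T Du z‖ + 1) ^ (p z * (1 - β))) ≤
        totalEnergy p β Ω T u Du + volume S := by
  have hmeas : MeasurableSet (spaceTimeDomain Ω T) := hΩ.measurableSet.prod measurableSet_Ioo
  calc ∫⁻ z in S, ENNReal.ofReal
        ((|zeroExt Ω T u z| + ‖zeroExt Ω T Du z‖ + 1) ^ (p z * (1 - β)))
      ≤ ∫⁻ z in S, ((spaceTimeDomain Ω T).indicator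
          (fun z => ENNReal.ofReal ((|u z| + ‖Du z‖ + 1) ^ (p z * (1 - β)))) z + 1) := by
        refine lintegral_mono fun z => ?_
        by_cases hz : z ∈ spaceTimeDomain Ω T
        · simp [zeroExt, hz]
        · simp [zeroExt, hz]
    _ = (∫⁻ z in S, (spaceTimeDomain Ω T).indicator
          (fun z => ENNReal.ofReal ((|u z| + ‖Du z‖ + 1) ^ (p z * (1 - β)))) z) + volume S := by
        rw [lintegral_add_right _ measurable_const, setLIntegral_one]
    _ ≤ _ := by
        gcongr
        refine (setLIntegral_le_lintegral _ _).trans_eq ?_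
        rw [lintegral_indicator hmeas, totalEnergy]

/-- The part of the hypotheses of the covering lemma that determines the comparability constant. -/
structure IsSetting (pm pp L q β₀ : ℝ) (Ω : Set (EuclideanSpace ℝ (Fin n))) (T : ℝ)
    (p : SpaceTime n → ℝ) (om : ℝ → ℝ) (β : ℝ) (u : SpaceTime n → ℝ)
    (Du : SpaceTime n → EuclideanSpace ℝ (Fin n)) (z₀ : SpaceTime n) (d α₀ ρ ρb lam P : ℝ) :
    Prop where
  one_le_n : 1 ≤ n
  q_gt : 1 < q
  β₀_pos : 0 < β₀
  s_gt : 1 < q * (1 - β₀)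
  pm_gt : 1 < pm
  holder : IsLogHolder pm pp L p om
  isOpen : IsOpen Ω
  β_pos : 0 < β
  β_lt : β < β₀
  β₀_le : β₀ ≤ 1 / 2
  mem : MemLpW01 (fun z => p z * (1 - β)) Ω T u Du
  ρ_pos : 0 < ρ
  ρ_le : 128 * ρ ≤ 1
  energy : totalEnergy p β Ω T u Du ≤ ENNReal.ofReal (1 / ρ)
  om_le : om (32 * ρ) ≤ 1
  P_pos : 0 < P
  P_le : ∀ z ∈ cylinder z₀ (16 * ρ) (16 * ρ), P ≤ p z
  β₀_d : 2 * β₀ ≤ d * (n + 2) / 2 - n / P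
  d_pos : 0 < d
  d_le : d ≤ 1
  d_p : ∀ z ∈ cylinder z₀ (16 * ρ) (16 * ρ), 0 ≤ 1 / p z - d / 2
  one_le_α : 1 ≤ α₀
  mean : ENNReal.ofReal (α₀ ^ (1 - β)) ≤ meanEnergy p β Ω T Du (intrinsicCylinder p d α₀ z₀ ρ)
  ρb_pos : 0 < ρb
  ρb_le : ρb ≤ 16 * ρ
  α_le : α₀ ≤ lam

/-- The constant in the bound for `α₀`. -/
noncomputable def levelConst (n : ℕ) : ℝ := max 1 ((1 + 2 * unitVol n) / (2 * unitVol n))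

/-- The constant in the bound for `λ`. -/
noncomputable def upperLevelConst (n : ℕ) (s : ℝ) : ℝ :=
  max 1 ((strongConst n s).toReal * 4 ^ s * ((1 + 2 * unitVol n) / (2 * unitVol n)))

namespace IsSetting

variable {pm pp L q β₀ : ℝ} {Ω : Set (EuclideanSpace ℝ (Fin n))} {T : ℝ}
  {p : SpaceTime n → ℝ} {om : ℝ → ℝ} {β : ℝ} {u : SpaceTime n → ℝ}
  {Du : SpaceTime n → EuclideanSpace ℝ (Fin n)} {z₀ : SpaceTime n} {d α₀ ρ ρb lam P : ℝ}

theorem mem_cylinder (h : IsSetting pm pp L q β₀ Ω T p om β u Du z₀ d α₀ ρ ρb lam P) :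
    z₀ ∈ cylinder z₀ (16 * ρ) (16 * ρ) := by
  have := h.ρ_pos
  refine ⟨Metric.mem_ball_self (by positivity), ?_, ?_⟩
  · have : 0 < (16 * ρ) ^ 2 := by positivity
    linarith
  · have : 0 < (16 * ρ) ^ 2 := by positivity
    linarith

theorem scaleX_le_one (h : IsSetting pm pp L q β₀ Ω T p om β u Du z₀ d α₀ ρ ρb lam P) :
    scaleX p d α₀ z₀ ≤ 1 :=
  Real.rpow_le_one_of_one_le_of_nonpos h.one_le_α (by linarith [h.d_p _ h.mem_cylinder])

theorem scaleT_le_one (h : IsSetting pm pp L q β₀ Ω T p om β u Du z₀ d α₀ ρ ρb lam P) :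
    scaleT d α₀ ≤ 1 :=
  Real.rpow_le_one_of_one_le_of_nonpos h.one_le_α (by linarith [h.d_le])

theorem subset_cylinder (h : IsSetting pm pp L q β₀ Ω T p om β u Du z₀ d α₀ ρ ρb lam P) :
    intrinsicCylinder p d α₀ z₀ ρb ⊆ cylinder z₀ (16 * ρ) (16 * ρ) := by
  have hα : 0 < α₀ := by linarith [h.one_le_α]
  have hX := scaleX_pos (p := p) (d := d) hα z₀
  have hT := scaleT_pos (d := d) hα
  have hb := h.ρb_pos
  have h1 : scaleX p d α₀ z₀ * ρb ≤ 16 * ρ := by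
    calc _ ≤ 1 * (16 * ρ) := mul_le_mul h.scaleX_le_one h.ρb_le hb.le zero_le_one
      _ = _ := one_mul _
  have h2 : scaleT d α₀ * ρb ^ 2 ≤ (16 * ρ) ^ 2 := by
    calc _ ≤ 1 * (16 * ρ) ^ 2 := mul_le_mul h.scaleT_le_one
          (pow_le_pow_left₀ hb.le h.ρb_le 2) (by positivity) zero_le_one
      _ = _ := one_mul _
  exact prod_mono (Metric.ball_subset_ball h1) (Ioo_subset_Ioo (by linarith) (by linarith))

theorem energy_add_volume_le (h : IsSetting pm pp L q β₀ Ω T p om β u Du z₀ d α₀ ρ ρb lam P)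
    {r : ℝ} (hr : 0 < r) (hr1 : r ≤ 1) :
    totalEnergy p β Ω T u Du + volume (intrinsicCylinder p d α₀ z₀ r) ≤
      ENNReal.ofReal ((1 + 2 * unitVol n) / ρ) := by
  have hα : 0 < α₀ := by linarith [h.one_le_α]
  have hX := scaleX_pos (p := p) (d := d) hα z₀
  have hT := scaleT_pos (d := d) hα
  have hω := unitVol_pos n
  have hρ := h.ρ_pos
  rw [volume_intrinsicCylinder_eq_ofReal hα z₀ hr, add_div, ENNReal.ofReal_add (by positivity)
    (by positivity)]
  refine add_le_add h.energy (ENNReal.ofReal_le_ofReal ?_)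
  rw [le_div_iff₀ hρ]
  have h1 : scaleX p d α₀ z₀ ^ n * scaleT d α₀ ≤ 1 :=
    mul_le_one₀ (pow_le_one₀ hX.le h.scaleX_le_one) hT.le h.scaleT_le_one
  have h2 : r ^ (n + 2) ≤ 1 := pow_le_one₀ hr.le hr1
  calc 2 * unitVol n * (scaleX p d α₀ z₀ ^ n * scaleT d α₀) * r ^ (n + 2) * ρ
      ≤ 2 * unitVol n * 1 * 1 * 1 := by
        gcongr; linarith [h.ρ_le]
    _ = _ := by ring

/-- The lower mean bound gives α₀^{1-β}|Q_ρ^{α₀}| ≤ M₀ + |Q_ρ^{α₀}|, and both terms are at most a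
constant over ρ. -/
theorem level_le (h : IsSetting pm pp L q β₀ Ω T p om β u Du z₀ d α₀ ρ ρb lam P) :
    α₀ ^ β₀ * ρ ^ (n + 3) ≤ levelConst n := by
  have hα : 0 < α₀ := by linarith [h.one_le_α]
  have hω := unitVol_pos n
  have hρ := h.ρ_pos
  have hmean := h.mean
  rw [meanEnergy, setLAverage_eq] at hmean
  have h1 := (ofReal_le_rpow_mul_volume h.one_le_α h.β_lt.le h.P_pos (h.P_le _ h.mem_cylinder)
    h.β₀_d hρ).trans (ENNReal.mul_le_of_le_div hmean)
  have h2 : ∫⁻ z in intrinsicCylinder p d α₀ z₀ ρ,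
      ENNReal.ofReal ((‖zeroExt Ω T Du z‖ + 1) ^ (p z * (1 - β))) ≤
      ENNReal.ofReal ((1 + 2 * unitVol n) / ρ) := by
    refine le_trans ?_ ((setLIntegral_zeroExt_le h.isOpen T u Du _).trans
      (h.energy_add_volume_le hρ (by linarith [h.ρ_le])))
    refine lintegral_mono fun z => ENNReal.ofReal_le_ofReal ?_
    have hp : 1 < p z := h.pm_gt.trans_le (h.holder.bounds z).1
    have hβ : 0 < 1 - β := by linarith [h.β_lt, h.β₀_le]
    refine Real.rpow_le_rpow (by positivity) ?_ (by positivity)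
    linarith [abs_nonneg (zeroExt Ω T u z)]
  have h3 := (ENNReal.ofReal_le_ofReal_iff (by positivity)).1 (h1.trans h2)
  refine le_max_of_le_right ?_
  rw [le_div_iff₀ (by positivity)]
  rw [le_div_iff₀ hρ] at h3
  calc _ = 2 * unitVol n * (α₀ ^ β₀ * ρ ^ (n + 2)) * ρ := by ring
    _ ≤ _ := h3

theorem aemeasurable_truncatedFun
    (h : IsSetting pm pp L q β₀ Ω T p om β u Du z₀ d α₀ ρ ρb lam P) :
    AEMeasurable (truncatedFun p d q Ω T u Du α₀ z₀ ρ ρb) := by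
  have hmeas : MeasurableSet (spaceTimeDomain Ω T) :=
    h.isOpen.measurableSet.prod measurableSet_Ioo
  have hu : AEMeasurable (zeroExt Ω T u) :=
    ((aestronglyMeasurable_indicator_iff hmeas).2 h.mem.meas).aemeasurable
  have hDu : AEMeasurable (zeroExt Ω T Du) :=
    ((aestronglyMeasurable_indicator_iff hmeas).2 h.mem.meas_grad).aemeasurable
  have hp : Measurable p := h.holder.continuous.measurable
  refine AEMeasurable.indicator ?_ (isOpen_intrinsicCylinder _ _).measurableSet
  refine AEMeasurable.ennreal_ofReal (AEMeasurable.pow ?_ (hp.div_const q).aemeasurable)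
  exact (hDu.norm.add_const 1).add (hu.abs.div_const _)

theorem inv_scale_le (h : IsSetting pm pp L q β₀ Ω T p om β u Du z₀ d α₀ ρ ρb lam P) :
    (scaleX p d α₀ z₀ * ρ)⁻¹ ≤ α₀ / ρ := by
  have hα : 0 < α₀ := by linarith [h.one_le_α]
  have hρ := h.ρ_pos
  have hp : 1 < p z₀ := h.pm_gt.trans_le (h.holder.bounds z₀).1
  have hp' : 1 / p z₀ ≤ 1 := by rw [div_le_one (by linarith)]; linarith
  rw [scaleX_eq_inv hα, mul_inv, inv_inv, div_eq_mul_inv α₀]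
  gcongr
  calc α₀ ^ (1 / p z₀ - d / 2) ≤ α₀ ^ (1 : ℝ) :=
        Real.rpow_le_rpow_of_exponent_le h.one_le_α (by linarith [h.d_pos])
    _ = α₀ := Real.rpow_one _

/-- The exponent is s = q(1-β₀), not q(1-β), so that the weak type constant is independent of β. The
integrand has base at least 1 and power p(1-β₀) ≤ p(1-β), hence the energy controls it; the weight
on |u| costs at most (α₀/ρ)^{pp}. -/
theorem lintegral_truncatedFun_le
    (h : IsSetting pm pp L q β₀ Ω T p om β u Du z₀ d α₀ ρ ρb lam P) :
    ∫⁻ z, truncatedFun p d q Ω T u Du α₀ z₀ ρ ρb z ^ (q * (1 - β₀)) ≤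
      ENNReal.ofReal ((α₀ / ρ) ^ pp * ((1 + 2 * unitVol n) / ρ)) := by
  have hα : 0 < α₀ := by linarith [h.one_le_α]
  have hρ := h.ρ_pos
  have hρ1 : ρ ≤ 1 := by linarith [h.ρ_le]
  have hω := unitVol_pos n
  have hX := scaleX_pos (p := p) (d := d) hα z₀
  have hs : 0 < q * (1 - β₀) := by linarith [h.s_gt]
  have hq : 0 < q := by linarith [h.q_gt]
  have hQ : MeasurableSet (intrinsicCylinder p d α₀ z₀ ρb) :=
    (isOpen_intrinsicCylinder _ _).measurableSet
  set c := scaleX p d α₀ z₀ * ρ with hc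
  have hc0 : 0 < c := by positivity
  have hc1 : c ≤ 1 := mul_le_one₀ h.scaleX_le_one hρ.le hρ1
  have hcinv : 1 ≤ c⁻¹ := (one_le_inv₀ hc0).2 hc1
  have hpt : ∀ z, truncatedFun p d q Ω T u Du α₀ z₀ ρ ρb z ^ (q * (1 - β₀)) ≤
      (intrinsicCylinder p d α₀ z₀ ρb).indicator (fun z => ENNReal.ofReal ((α₀ / ρ) ^ pp) *
        ENNReal.ofReal ((|zeroExt Ω T u z| + ‖zeroExt Ω T Du z‖ + 1) ^ (p z * (1 - β)))) z := by
    intro z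
    by_cases hz : z ∈ intrinsicCylinder p d α₀ z₀ ρb
    · rw [truncatedFun, indicator_of_mem hz, indicator_of_mem hz, ← hc]
      set a := |zeroExt Ω T u z|
      set b := ‖zeroExt Ω T Du z‖
      have ha : 0 ≤ a := abs_nonneg _
      have hb : 0 ≤ b := norm_nonneg _
      have hY : 1 ≤ b + 1 + a / c := by
        have : 0 ≤ a / c := by positivity
        linarith
      have hp : 1 < p z := h.pm_gt.trans_le (h.holder.bounds z).1
      have hβ : 0 < 1 - β := by linarith [h.β_lt, h.β₀_le]
      have hβ1 : 1 - β ≤ 1 := by linarith [h.β_pos]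
      rw [ENNReal.ofReal_rpow_of_pos (by positivity), ← Real.rpow_mul (by positivity),
        ← ENNReal.ofReal_mul (by positivity)]
      refine ENNReal.ofReal_le_ofReal ?_
      have e : p z / q * (q * (1 - β₀)) = p z * (1 - β₀) := by field_simp
      rw [e]
      calc (b + 1 + a / c) ^ (p z * (1 - β₀)) ≤ (b + 1 + a / c) ^ (p z * (1 - β)) := by
            refine Real.rpow_le_rpow_of_exponent_le hY ?_
            have := h.β_lt
            gcongr
        _ ≤ (c⁻¹ * (a + b + 1)) ^ (p z * (1 - β)) := by
            refine Real.rpow_le_rpow (by positivity) ?_ (by positivity)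
            have : b + 1 ≤ c⁻¹ * (b + 1) := le_mul_of_one_le_left (by positivity) hcinv
            calc b + 1 + a / c ≤ c⁻¹ * (b + 1) + a / c := by linarith
              _ = _ := by ring
        _ = c⁻¹ ^ (p z * (1 - β)) * (a + b + 1) ^ (p z * (1 - β)) :=
            Real.mul_rpow (by positivity) (by positivity)
        _ ≤ (α₀ / ρ) ^ pp * (a + b + 1) ^ (p z * (1 - β)) := by
            gcongr
            calc c⁻¹ ^ (p z * (1 - β)) ≤ c⁻¹ ^ pp := by
                  refine Real.rpow_le_rpow_of_exponent_le hcinv ?_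
                  calc p z * (1 - β) ≤ p z * 1 := by gcongr
                    _ ≤ pp := by rw [mul_one]; exact (h.holder.bounds z).2
              _ ≤ _ := Real.rpow_le_rpow (by positivity) h.inv_scale_le
                  (by linarith [(h.holder.bounds z).2])
    · rw [truncatedFun, indicator_of_notMem hz, indicator_of_notMem hz, ENNReal.zero_rpow_of_pos hs]
  calc _ ≤ ∫⁻ z, (intrinsicCylinder p d α₀ z₀ ρb).indicator
        (fun z => ENNReal.ofReal ((α₀ / ρ) ^ pp) *
        ENNReal.ofReal ((|zeroExt Ω T u z| + ‖zeroExt Ω T Du z‖ + 1) ^ (p z * (1 - β)))) z :=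
        lintegral_mono hpt
    _ = ENNReal.ofReal ((α₀ / ρ) ^ pp) * ∫⁻ z in intrinsicCylinder p d α₀ z₀ ρb,
        ENNReal.ofReal ((|zeroExt Ω T u z| + ‖zeroExt Ω T Du z‖ + 1) ^ (p z * (1 - β))) := by
        rw [lintegral_indicator hQ, lintegral_const_mul' _ _ ENNReal.ofReal_ne_top]
    _ ≤ ENNReal.ofReal ((α₀ / ρ) ^ pp) * ENNReal.ofReal ((1 + 2 * unitVol n) / ρ) := by
        gcongr
        exact (setLIntegral_zeroExt_le h.isOpen T u Du _).trans
          (h.energy_add_volume_le h.ρb_pos (by linarith [h.ρb_le, h.ρ_le]))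
    _ = _ := by rw [← ENNReal.ofReal_mul (by positivity)]

theorem upperLevel_le (h : IsSetting pm pp L q β₀ Ω T p om β u Du z₀ d α₀ ρ ρb lam P)
    {z : SpaceTime n} (hz : z ∈ cylinder z₀ (16 * ρ) (16 * ρ)) {r : ℝ} (hr : 0 < r)
    (hsub : intrinsicCylinder p d lam z r ⊆ (goodSet p d q β Ω T u Du α₀ z₀ ρ ρb lam)ᶜ) :
    lam ^ β₀ * r ^ (n + 2) ≤ upperLevelConst n (q * (1 - β₀)) * ((α₀ / ρ) ^ pp / ρ) := by
  have hα : 0 < α₀ := by linarith [h.one_le_α]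
  have hlam1 : 1 ≤ lam := h.one_le_α.trans h.α_le
  have hlam : 0 < lam := by linarith
  have hρ := h.ρ_pos
  have hω := unitVol_pos n
  have hq : 0 < q := by linarith [h.q_gt]
  have hs := h.s_gt
  set s := q * (1 - β₀) with hsdef
  rw [goodSet_eq hq (by linarith [h.β_lt, h.β₀_le]) hlam] at hsub
  have hl : 0 < lam ^ (1 / q) / 4 := by positivity
  have h4 : 4 * ENNReal.ofReal (lam ^ (1 / q) / 4) = ENNReal.ofReal (lam ^ (1 / q)) := by
    rw [← ENNReal.ofReal_ofNat 4, ← ENNReal.ofReal_mul (by norm_num)]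
    congr 1
    ring
  -- The weak type estimate loses a factor 4 in the level, so l = λ^{1/q}/4, and l^s is a multiple
  -- of λ^{1-β₀}.
  have h1 := rpow_mul_volume_le_of_lt_strongMaximal₀ h.one_le_n h.aemeasurable_truncatedFun hs
    (l := ENNReal.ofReal (lam ^ (1 / q) / 4)) (by simpa using hl) ENNReal.ofReal_ne_top
    (B := intrinsicBall p d lam z r) (I := intrinsicInterval d lam z r) measurableSet_Ioo
    (fun w hw => by
      have := hsub hw
      rw [h4]
      simpa using this)
  have e1 : (lam ^ (1 / q) / 4) ^ s = (4 ^ s)⁻¹ * lam ^ (1 - β₀) := by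
    rw [Real.div_rpow (by positivity) (by norm_num), ← Real.rpow_mul hlam.le, div_eq_inv_mul]
    congr 2
    rw [hsdef]; field_simp
  rw [← volume_intrinsicCylinder, ENNReal.ofReal_rpow_of_pos hl, e1,
    ENNReal.ofReal_mul (by positivity), mul_assoc] at h1
  have h2 := (mul_le_mul' le_rfl (ofReal_le_rpow_mul_volume (b := β₀) hlam1 le_rfl h.P_pos
    (h.P_le z hz) h.β₀_d hr)).trans (h1.trans (mul_le_mul' le_rfl h.lintegral_truncatedFun_le))
  rw [← ENNReal.ofReal_toReal (strongConst_ne_top n hs), ← ENNReal.ofReal_mul (by positivity),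
    ← ENNReal.ofReal_mul (by positivity), ENNReal.ofReal_le_ofReal_iff (by positivity),
    inv_mul_le_iff₀ (by positivity)] at h2
  calc lam ^ β₀ * r ^ (n + 2)
      ≤ ((strongConst n s).toReal * 4 ^ s * ((1 + 2 * unitVol n) / (2 * unitVol n))) *
        ((α₀ / ρ) ^ pp / ρ) := by
        rw [← mul_le_mul_iff_right₀ (show 0 < 2 * unitVol n by positivity)]
        refine h2.trans_eq ?_
        field_simp
    _ ≤ _ := by
        gcongr
        exact le_max_right _ _

end IsSetting

end Whitney

/-! ### Logarithmic bound for λ and comparability of exponents -/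

namespace Whitney

variable {n : ℕ}

/-- The constant term in the bound for `log λ`. -/
noncomputable def logConst (n : ℕ) (pp q β₀ : ℝ) : ℝ :=
  (Real.log (upperLevelConst n (q * (1 - β₀))) + pp * (Real.log (levelConst n) / β₀)) / β₀

/-- The coefficient of `log (1 / ρ)` in the bound for `log λ`. -/
noncomputable def logCoeff (n : ℕ) (pp β₀ : ℝ) : ℝ := (pp * ((n + 3) / β₀ + 1) + 1) / β₀

/-- The exponent of the comparability constant. -/
noncomputable def compExponent (n : ℕ) (pp L q β₀ : ℝ) : ℝ :=
  logConst n pp q β₀ + logCoeff n pp β₀ * Real.log 32 + (logCoeff n pp β₀ + (n + 2) / β₀) * L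

theorem logConst_nonneg (n : ℕ) {pp q β₀ : ℝ} (hpp : 0 ≤ pp) (hβ₀ : 0 < β₀) :
    0 ≤ logConst n pp q β₀ := by
  have h1 : 0 ≤ Real.log (upperLevelConst n (q * (1 - β₀))) := Real.log_nonneg (le_max_left _ _)
  have h2 : 0 ≤ Real.log (levelConst n) := Real.log_nonneg (le_max_left _ _)
  unfold logConst
  positivity

theorem logCoeff_nonneg (n : ℕ) {pp β₀ : ℝ} (hpp : 0 ≤ pp) (hβ₀ : 0 < β₀) :
    0 ≤ logCoeff n pp β₀ := by
  unfold logCoeff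
  positivity

theorem compExponent_nonneg (n : ℕ) {pp L q β₀ : ℝ} (hpp : 0 ≤ pp) (hL : 0 ≤ L) (hβ₀ : 0 < β₀) :
    0 ≤ compExponent n pp L q β₀ := by
  have h1 := logConst_nonneg n (q := q) hpp hβ₀
  have h2 := logCoeff_nonneg n hpp hβ₀
  have h3 : 0 ≤ Real.log 32 := Real.log_nonneg (by norm_num)
  unfold compExponent
  positivity

namespace IsSetting

variable {pm pp L q β₀ : ℝ} {Ω : Set (EuclideanSpace ℝ (Fin n))} {T : ℝ}
  {p : SpaceTime n → ℝ} {om : ℝ → ℝ} {β : ℝ} {u : SpaceTime n → ℝ}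
  {Du : SpaceTime n → EuclideanSpace ℝ (Fin n)} {z₀ : SpaceTime n} {d α₀ ρ ρb lam P : ℝ}

theorem pp_pos (h : IsSetting pm pp L q β₀ Ω T p om β u Du z₀ d α₀ ρ ρb lam P) : 0 < pp := by
  have := h.holder.bounds z₀
  linarith [h.pm_gt]

theorem log_lam_le (h : IsSetting pm pp L q β₀ Ω T p om β u Du z₀ d α₀ ρ ρb lam P)
    {z : SpaceTime n} (hz : z ∈ cylinder z₀ (16 * ρ) (16 * ρ)) {r : ℝ} (hr : 0 < r)
    (hsub : intrinsicCylinder p d lam z r ⊆ (goodSet p d q β Ω T u Du α₀ z₀ ρ ρb lam)ᶜ) :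
    Real.log lam ≤ logConst n pp q β₀ + logCoeff n pp β₀ * Real.log (1 / ρ) +
      (n + 2) / β₀ * Real.log (1 / r) := by
  have hα : 0 < α₀ := by linarith [h.one_le_α]
  have hlam : 0 < lam := by linarith [h.α_le]
  have hρ := h.ρ_pos
  have hβ₀ := h.β₀_pos
  have hpp := h.pp_pos
  have hK1 : 0 < levelConst n := lt_max_of_lt_left one_pos
  have hK2 : 0 < upperLevelConst n (q * (1 - β₀)) := lt_max_of_lt_left one_pos
  have h1 := Real.log_le_log (by positivity) h.level_le
  have h2 := Real.log_le_log (by positivity) (h.upperLevel_le hz hr hsub)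
  rw [Real.log_mul (by positivity) (by positivity), Real.log_rpow hα, Real.log_pow] at h1
  rw [Real.log_mul (by positivity) (by positivity), Real.log_rpow hlam, Real.log_pow,
    Real.log_mul (by positivity) (by positivity), Real.log_div (by positivity) (by positivity),
    Real.log_rpow (by positivity), Real.log_div (by positivity) (by positivity)] at h2
  push_cast at h1 h2
  rw [Real.log_div one_ne_zero hρ.ne', Real.log_div one_ne_zero hr.ne', Real.log_one]
  have h3 : Real.log α₀ ≤ (Real.log (levelConst n) - (n + 3) * Real.log ρ) / β₀ := by
    rw [le_div_iff₀ hβ₀]; linarith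
  have h4 : Real.log lam ≤ (Real.log (upperLevelConst n (q * (1 - β₀))) +
      (pp * ((Real.log (levelConst n) - (n + 3) * Real.log ρ) / β₀ - Real.log ρ) - Real.log ρ) -
      (n + 2) * Real.log r) / β₀ := by
    rw [le_div_iff₀ hβ₀]
    have := mul_le_mul_of_nonneg_left h3 hpp.le
    linarith
  refine h4.trans_eq ?_
  unfold logConst logCoeff
  field_simp
  ring

/-- If E were empty, `upperLevel_le` would hold at z₀ for every radius with a right-hand side
independent of the radius. -/
theorem goodSet_nonempty (h : IsSetting pm pp L q β₀ Ω T p om β u Du z₀ d α₀ ρ ρb lam P) :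
    (goodSet p d q β Ω T u Du α₀ z₀ ρ ρb lam).Nonempty := by
  by_contra hne
  rw [not_nonempty_iff_eq_empty] at hne
  set M := upperLevelConst n (q * (1 - β₀)) * ((α₀ / ρ) ^ pp / ρ) with hM
  have hr : (1 : ℝ) ≤ max 1 (M + 1) := le_max_left _ _
  have h1 : lam ^ β₀ * max 1 (M + 1) ^ (n + 2) ≤ M :=
    h.upperLevel_le h.mem_cylinder (by linarith) (by rw [hne, compl_empty]; exact subset_univ _)
  have h2 : 1 ≤ lam ^ β₀ := Real.one_le_rpow (h.one_le_α.trans h.α_le) h.β₀_pos.le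
  have h3 : max 1 (M + 1) ≤ max 1 (M + 1) ^ (n + 2) := le_self_pow₀ hr (by omega)
  have h4 : max 1 (M + 1) ^ (n + 2) ≤ lam ^ β₀ * max 1 (M + 1) ^ (n + 2) :=
    le_mul_of_one_le_left (by positivity) h2
  have h5 : M + 1 ≤ max 1 (M + 1) := le_max_right _ _
  linarith

theorem parDist_le (h : IsSetting pm pp L q β₀ Ω T p om β u Du z₀ d α₀ ρ ρb lam P)
    {z w : SpaceTime n} (hz : z ∈ cylinder z₀ (16 * ρ) (16 * ρ))
    (hw : w ∈ cylinder z₀ (16 * ρ) (16 * ρ)) : parDist z w ≤ 32 * ρ := by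
  have hρ := h.ρ_pos
  refine max_le ?_ (Real.sqrt_le_iff.2 ⟨by positivity, ?_⟩)
  · have h1 := hz.1
    have h2 := hw.1
    rw [Metric.mem_ball] at h1 h2
    linarith [dist_triangle_right z.1 w.1 z₀.1]
  · have h1 := hz.2
    have h2 := hw.2
    rw [abs_le]
    constructor <;> nlinarith [h1.1, h1.2, h2.1, h2.2]

theorem rpow_abs_le (h : IsSetting pm pp L q β₀ Ω T p om β u Du z₀ d α₀ ρ ρb lam P)
    {z w v : SpaceTime n} (hz : z ∈ cylinder z₀ (16 * ρ) (16 * ρ))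
    (hw : w ∈ cylinder z₀ (16 * ρ) (16 * ρ)) (hv : v ∈ cylinder z₀ (16 * ρ) (16 * ρ))
    (hle : parDist z w ≤ distToSet p d lam (goodSet p d q β Ω T u Du α₀ z₀ ρ ρb lam) v) :
    lam ^ |1 / p z - 1 / p w| ≤ Real.exp (compExponent n pp L q β₀) := by
  have hlam1 : 1 ≤ lam := h.one_le_α.trans h.α_le
  have hlam : 0 < lam := by linarith
  have hρ := h.ρ_pos
  have hA0 := logConst_nonneg n (q := q) h.pp_pos.le h.β₀_pos
  have hA1 := logCoeff_nonneg n h.pp_pos.le h.β₀_pos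
  have hA2 : 0 ≤ ((n : ℝ) + 2) / β₀ := by have := h.β₀_pos; positivity
  have h32 : 0 ≤ Real.log 32 := Real.log_nonneg (by norm_num)
  have hpz : 1 < p z := h.pm_gt.trans_le (h.holder.bounds z).1
  have hpw : 1 < p w := h.pm_gt.trans_le (h.holder.bounds w).1
  have hs32 := h.parDist_le hz hw
  have hmod := h.holder.modulus z w
  have hs0 : 0 ≤ parDist z w := le_max_of_le_right (Real.sqrt_nonneg _)
  set s := parDist z w with hs
  have hdiff : |1 / p z - 1 / p w| ≤ om s := by
    refine le_trans ?_ hmod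
    have e : 1 / p z - 1 / p w = (p w - p z) / (p z * p w) := by
      have : p z ≠ 0 := by linarith
      have : p w ≠ 0 := by linarith
      field_simp
    rw [e, abs_div, abs_sub_comm]
    refine div_le_self (abs_nonneg _) ?_
    rw [abs_of_pos (by positivity)]
    nlinarith
  have hloglam : 0 ≤ Real.log lam := Real.log_nonneg hlam1
  rw [Real.rpow_def_of_pos hlam, Real.exp_le_exp]
  -- For s = 0 the logarithmic bound is void, but then z = w and the left-hand exponent vanishes.
  rcases hs0.eq_or_lt with h0 | hspos
  · have hzw : z = w := by
      have h1 : dist z.1 w.1 ≤ s := le_max_left _ _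
      have h2 : √|z.2 - w.2| ≤ s := le_max_right _ _
      rw [← h0] at h1 h2
      refine Prod.ext (dist_le_zero.1 h1) ?_
      have h3 := (Real.sqrt_eq_zero (abs_nonneg _)).1 (le_antisymm h2 (Real.sqrt_nonneg _))
      linarith [abs_eq_zero.1 h3]
    have hL : 0 ≤ L := by
      have h1 := h.holder.log_bound (1 / 2) (by norm_num) le_rfl
      have h2 := h.holder.nonneg (1 / 2) (by norm_num)
      have h3 : 0 ≤ Real.log (1 / (1 / 2)) := Real.log_nonneg (by norm_num)
      nlinarith [mul_nonneg h2 h3]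
    rw [hzw, sub_self, abs_zero, mul_zero]
    exact compExponent_nonneg n h.pp_pos.le hL h.β₀_pos
  have hlog := h.log_lam_le hv hspos (subset_compl_of_le_distToSet hlam hspos hle)
  have hL := h.holder.log_bound s hspos (by linarith [h.ρ_le])
  have hom0 := h.holder.nonneg s hs0
  have hom1 : om s ≤ 1 := (h.holder.mono hs0 (by simp only [mem_Ici]; positivity) hs32).trans h.om_le
  -- Since s ≤ 32ρ, the dependence on ρ is absorbed into log(1/s); this yields the term with log 32
  -- in `compExponent`.
  have hlogρ : Real.log (1 / ρ) ≤ Real.log 32 + Real.log (1 / s) := by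
    rw [← Real.log_mul (by norm_num) (by positivity)]
    refine Real.log_le_log (by positivity) ?_
    rw [mul_one_div, div_le_div_iff₀ hρ hspos]
    linarith
  set ℓ := Real.log (1 / s) with hℓ
  have h1 : Real.log lam ≤ (logConst n pp q β₀ + logCoeff n pp β₀ * Real.log 32) +
      (logCoeff n pp β₀ + (n + 2) / β₀) * ℓ := by
    have := mul_le_mul_of_nonneg_left hlogρ hA1
    linarith
  calc Real.log lam * |1 / p z - 1 / p w| ≤ Real.log lam * om s := by gcongr
    _ ≤ ((logConst n pp q β₀ + logCoeff n pp β₀ * Real.log 32) +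
      (logCoeff n pp β₀ + (n + 2) / β₀) * ℓ) * om s := by gcongr
    _ = (logConst n pp q β₀ + logCoeff n pp β₀ * Real.log 32) * om s +
      (logCoeff n pp β₀ + (n + 2) / β₀) * (om s * ℓ) := by ring
    _ ≤ (logConst n pp q β₀ + logCoeff n pp β₀ * Real.log 32) * 1 +
      (logCoeff n pp β₀ + (n + 2) / β₀) * L := by gcongr
    _ = _ := by rw [mul_one, compExponent]

theorem isComparable (h : IsSetting pm pp L q β₀ Ω T p om β u Du z₀ d α₀ ρ ρb lam P)
    (hL : 0 ≤ L) :
    IsComparable p d lam (Real.exp (compExponent n pp L q β₀)) (intrinsicCylinder p d α₀ z₀ ρb)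
      (goodSet p d q β Ω T u Du α₀ z₀ ρ ρb lam) where
  one_le := Real.one_le_exp (compExponent_nonneg n h.pp_pos.le hL h.β₀_pos)
  one_le_lam := h.one_le_α.trans h.α_le
  le_one := h.d_le
  exp_nonneg z hz := h.d_p z (h.subset_cylinder hz)
  exp_le_one z _ := by
    have hp : 1 < p z := h.pm_gt.trans_le (h.holder.bounds z).1
    have : 1 / p z ≤ 1 := by rw [div_le_one (by linarith)]; linarith
    linarith [h.d_pos]
  bounded := Metric.isBounded_ball.prod (Metric.isBounded_Ioo _ _)
  closed := isClosed_goodSet (by linarith [h.q_gt]) (by linarith [h.β_lt, h.β₀_le])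
    (by linarith [h.one_le_α, h.α_le])
  nonempty := h.goodSet_nonempty
  comparable z hz w hw hle := by
    have hz' := h.subset_cylinder hz.1
    have hw' := h.subset_cylinder hw.1
    rcases le_max_iff.1 hle with hle | hle
    · exact h.rpow_abs_le hz' hw' hz' hle
    · exact h.rpow_abs_le hz' hw' hw' hle

end IsSetting

end Whitney

/-! ### Choice of constants and verification of the setting -/

theorem mainTheorem5
    -- the data on which the constants may depend
    (n : ℕ) (hn : 1 ≤ n) (pm pp L m q β₀ : ℝ)
    (hpm_one : 1 < pm) (hpm : 2 * (n : ℝ) / (n + 2) < pm) (hpp : pm ≤ pp)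
    (hL : 0 < L) (hm : 0 < m) (hq : 1 < q)
    (hβ₀ : 0 < β₀) (hβ₀q : β₀ < 1 - 1 / q) (hβ₀half : β₀ ≤ 1 / 2)
    (hβ₀pm : 2 * (n : ℝ) / (n + 2) < pm - β₀) :
    ∃ (X chat C : ℝ) (N : ℕ), 9 ≤ X ∧ 9 ≤ chat ∧ 0 < C ∧
      ∀ (Ω : Set (EuclideanSpace ℝ (Fin n))) (T : ℝ) (p : Whitney.SpaceTime n → ℝ) (om : ℝ → ℝ)
        (β : ℝ) (u : Whitney.SpaceTime n → ℝ)
        (Du : Whitney.SpaceTime n → EuclideanSpace ℝ (Fin n))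
        (z₀ : Whitney.SpaceTime n) (ρ₀ d α₀ ρ ρa ρb lam : ℝ),
        -- the domain, the exponent and the function
        Whitney.IsMeasureDensityDomain m Ω → 0 < T →
        Whitney.IsLogHolder pm pp L p om →
        0 < β → β < β₀ → (∀ z, 1 < p z * (1 - β)) →
        Whitney.MemLpW01 (fun z => p z * (1 - β)) Ω T u Du →
        z₀.1 ∈ frontier Ω → z₀.2 ∈ Set.Ioo (-T) T →
        -- the restrictions on `ρ₀`
        0 < ρ₀ → ρ₀ < 1 →
        ENNReal.ofReal ρ₀ ≤ (1024 * Whitney.totalEnergy p β Ω T u Du)⁻¹ →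
        om (512 * ρ₀) ≤ 1 / 2 * min (1 / ((n : ℝ) + 2)) (1 / 4) →
        L / Real.log (1 / ρ₀) ≤ 1 / (n : ℝ) →
        -- the restrictions on `d`, `q` and `β₀` in terms of `p⁻` and `p⁺`
        2 * (n : ℝ) / ((n + 2) *
          Whitney.expInf p (Whitney.cylinder z₀ (128 * ρ₀) (128 * ρ₀))) < d →
        d < min (2 / Whitney.expSup p (Whitney.cylinder z₀ (128 * ρ₀) (128 * ρ₀))) 1 →
        q < Whitney.expInf p (Whitney.cylinder z₀ (128 * ρ₀) (128 * ρ₀)) /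
          (Whitney.expSup p (Whitney.cylinder z₀ (128 * ρ₀) (128 * ρ₀)) - 1) →
        2 * β₀ ≤ d * (n + 2) / 2 -
          n / Whitney.expInf p (Whitney.cylinder z₀ (128 * ρ₀) (128 * ρ₀)) →
        -- the base cylinder
        0 < ρ → 128 * ρ ≤ ρ₀ → 1 ≤ α₀ →
        ENNReal.ofReal (α₀ ^ (1 - β)) ≤
          Whitney.meanEnergy p β Ω T Du (Whitney.intrinsicCylinder p d α₀ z₀ ρ) →
        Whitney.meanEnergy p β Ω T Du (Whitney.intrinsicCylinder p d α₀ z₀ (16 * ρ)) ≤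
          ENNReal.ofReal (α₀ ^ (1 - β)) →
        ρ ≤ ρa → ρa < ρb → ρb ≤ 16 * ρ →
        α₀ ≤ lam →
        ∃ Z : Set (Whitney.SpaceTime n),
          Whitney.IsWhitneyCovering p d lam
            (Whitney.intrinsicCylinder p d α₀ z₀ ρb)
            (Whitney.goodSet p d q β Ω T u Du α₀ z₀ ρ ρb lam) X chat C N Z := by
  have hpp0 : 0 ≤ pp := by linarith
  have hΘ : 1 ≤ Real.exp (Whitney.compExponent n pp L q β₀) :=
    Real.one_le_exp (Whitney.compExponent_nonneg n hpp0 hL.le hβ₀)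
  refine ⟨9 * Real.exp (Whitney.compExponent n pp L q β₀),
    Whitney.enlargeConst (Real.exp (Whitney.compExponent n pp L q β₀)),
    Whitney.compConst n (Real.exp (Whitney.compExponent n pp L q β₀)),
    ⌈Whitney.overlapConst n (Real.exp (Whitney.compExponent n pp L q β₀))⌉₊,
    by linarith, by linarith [Whitney.ten_le_enlargeConst hΘ], Whitney.compConst_pos n hΘ, ?_⟩
  intro Ω T p om β u Du z₀ ρ₀ d α₀ ρ ρa ρb lam hΩ _ hp hβ hββ₀ _ hu _ _ hρ₀ hρ₀1 hM hom _ hd hd' _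
    hβ₀d hρ hρρ₀ hα hmean _ hρa hρab hρb hlam
  set S := Whitney.cylinder z₀ (128 * ρ₀) (128 * ρ₀) with hS
  have hbelow : BddBelow (p '' S) := ⟨pm, by rintro _ ⟨z, -, rfl⟩; exact (hp.bounds z).1⟩
  have habove : BddAbove (p '' S) := ⟨pp, by rintro _ ⟨z, -, rfl⟩; exact (hp.bounds z).2⟩
  have hsub : Whitney.cylinder z₀ (16 * ρ) (16 * ρ) ⊆ S := by
    have h1 : (16 * ρ) ^ 2 ≤ (128 * ρ₀) ^ 2 := pow_le_pow_left₀ (by positivity) (by linarith) 2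
    exact Set.prod_mono (Metric.ball_subset_ball (by linarith))
      (Set.Ioo_subset_Ioo (by linarith) (by linarith))
  have hz₀ : z₀ ∈ S := by
    have h1 : 0 < (128 * ρ₀) ^ 2 := by positivity
    exact ⟨Metric.mem_ball_self (by positivity), by linarith, by linarith⟩
  have hPpos : 0 < Whitney.expInf p S := by
    have : pm ≤ Whitney.expInf p S :=
      le_csInf ⟨_, Set.mem_image_of_mem p hz₀⟩ (by rintro _ ⟨z, -, rfl⟩; exact (hp.bounds z).1)
    linarith
  have hd0 : 0 < d := lt_of_le_of_lt (by positivity) hd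
  have hset : Whitney.IsSetting pm pp L q β₀ Ω T p om β u Du z₀ d α₀ ρ ρb lam
      (Whitney.expInf p S) :=
    { one_le_n := hn
      q_gt := hq
      β₀_pos := hβ₀
      -- This is β₀ < 1 - 1/q, the condition that keeps the weak type exponent above 1.
      s_gt := by
        have h1 : q * (1 / q) < q * (1 - β₀) := by
          refine mul_lt_mul_of_pos_left ?_ (by linarith)
          linarith
        rwa [mul_one_div_cancel (by linarith)] at h1
      pm_gt := hpm_one
      holder := hp
      isOpen := hΩ.isOpen
      β_pos := hβ
      β_lt := hββ₀
      β₀_le := hβ₀half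
      mem := hu
      ρ_pos := hρ
      ρ_le := by linarith
      energy := by
        have h1 := ENNReal.inv_le_inv.2 hM
        rw [inv_inv, ← ENNReal.ofReal_inv_of_pos hρ₀] at h1
        calc Whitney.totalEnergy p β Ω T u Du
            ≤ 1024 * Whitney.totalEnergy p β Ω T u Du :=
              le_mul_of_one_le_left' (by norm_num)
          _ ≤ ENNReal.ofReal ρ₀⁻¹ := h1
          _ ≤ _ := by
            refine ENNReal.ofReal_le_ofReal ?_
            rw [one_div]
            exact inv_anti₀ hρ (by linarith)
      om_le := by
        have h1 : om (32 * ρ) ≤ om (512 * ρ₀) :=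
          hp.mono (Set.mem_Ici.2 (by positivity)) (Set.mem_Ici.2 (by positivity)) (by linarith)
        have h2 := min_le_right (1 / ((n : ℝ) + 2)) (1 / 4)
        linarith
      P_pos := hPpos
      P_le := fun z hz => csInf_le hbelow (Set.mem_image_of_mem p (hsub hz))
      β₀_d := hβ₀d
      d_pos := hd0
      d_le := (hd'.trans_le (min_le_right _ _)).le
      -- From d < 2/p⁺: the spatial scaling then never enlarges a cylinder, and `parDist` is
      -- dominated by `locDist`.
      d_p := by
        intro z hz
        have h1 : p z ≤ Whitney.expSup p S := le_csSup habove (Set.mem_image_of_mem p (hsub hz))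
        have h2 : 1 < p z := hpm_one.trans_le (hp.bounds z).1
        have h3 := hd'.trans_le (min_le_left _ _)
        have h4 : 2 / Whitney.expSup p S ≤ 2 / p z := by gcongr
        have h5 : 2 / p z = 2 * (1 / p z) := by ring
        linarith
      one_le_α := hα
      mean := hmean
      ρb_pos := by linarith
      ρb_le := hρb
      α_le := hlam }
  exact (hset.isComparable hL.le).exists_isWhitneyCovering
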